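/- Let $k\ge 1$ be an integer and let $C_0^\infty(\mathbb R\times[0,\infty)^2)$ denote the space of complex-valued functions on $\mathbb R\times[0,\infty)^2$ that are smooth up to the boundary and have compact support (they need not vanish on the boundary). For $A$ in this space and $\lambda>0$ put $$J_A(\lambda)=\int_{\mathbb R\times[0,\infty)\times[0,\infty)} e^{-i\lambda\chi_0(\chi_1^2-\chi_2^{2k})}A(\chi_0,\chi_1,\chi_2)\,d\chi_0\,d\chi_1\,d\chi_2 .$$ Then there are distributions $C_l$ $(l\ge 0)$ and $D_j$ $(j\ge 0)$ on $\mathbb R\times[0,\infty)^2$, depending only on $k$, such that for every $A\in C_0^\infty(\mathbb R\times[0,\infty)^2)$, as $\lambda\to+\infty$, $$J_A(\lambda)\sim\sum_{l=0}^\infty \lambda^{-\frac{l+1}{2k}}\,C_l(A)+\sum_{j=0}^\infty \lambda^{-(j+1)}\log(\lambda)\,D_j(A).$$ Here a distribution on $\mathbb R\times[0,\infty)^2$ is a linear functional $T$ on $C_0^\infty(\mathbb R\times[0,\infty)^2)$ such that for every compact set $K$ there are $N\in\mathbb N$ and $M\in\mathbb R$ with $|T(A)|\le M\max_{i\le N}\sup_{\mathbb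 R\times[0,\infty)^2}\|D^iA\|$ for all $A$ supported in $K$; and the expansion means that for every integer $n\ge 0$ $$J_A(\lambda)-\sum_{0\le l<n}\lambda^{-\frac{l+1}{2k}}C_l(A)-\sum_{j\ge 0,\ j+1\le n/(2k)}\lambda^{-(j+1)}\log(\lambda)\,D_j(A)=o\big(\lambda^{-\frac{n}{2k}}\big),\qquad\lambda\to+\infty .$$ In particular logarithms occur only with the integer powers $\lambda^{-p}$, $p\ge 1$, and every coefficient is determined by $J_A$ through the successive limits that the expansion provides. -/

import Mathlib

open Set MeasureTheory Filter Asymptotics Topology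
open scoped ContDiff

namespace Hyperbolic

/-- The closed domain `ℝ × [0,∞) × [0,∞)`, with points `(χ₀, χ₁, χ₂)`. -/
def quadrant : Set (ℝ × ℝ × ℝ) := univ ×ˢ (Ici 0 ×ˢ Ici 0)

/-- The complex vector space `C₀^∞(ℝ × [0,∞)²)`: functions on `ℝ × [0,∞)²` that are smooth up to
the boundary and have compact support. An element is stored as a function on `ℝ³` that is zero
off the domain, so that it is determined by its values on `ℝ × [0,∞)²`; no smoothness across the
boundary is asked for, and nothing is required to vanish on the boundary. -/
def testFunctions : Submodule ℂ (ℝ × ℝ × ℝ → ℂ) where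
  carrier := {A | ContDiffOn ℝ ∞ A quadrant ∧ Function.support A ⊆ quadrant ∧ HasCompactSupport A}
  add_mem' := by
    rintro A B ⟨hA, hA', hA''⟩ ⟨hB, hB', hB''⟩
    exact ⟨hA.add hB, (Function.support_add A B).trans (union_subset hA' hB'), hA''.add hB''⟩
  zero_mem' := ⟨contDiffOn_const, by simp, HasCompactSupport.zero⟩
  smul_mem' := by
    rintro c A ⟨hA, hA', hA''⟩
    exact ⟨hA.const_smul c, (Function.support_const_smul_subset c A).trans hA',
      hA''.smul_left (f := fun _ => c)⟩

/-- A linear functional on `C₀^∞(ℝ × [0,∞)²)` is a distribution when on the test functions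
supported in a fixed compact set it is bounded by finitely many of the seminorms
`sup ‖DⁱA‖`, the suprema being over `ℝ × [0,∞)²`. -/
def IsDistribution (T : testFunctions →ₗ[ℂ] ℂ) : Prop :=
  ∀ K : Set (ℝ × ℝ × ℝ), IsCompact K → ∃ (N : ℕ) (M : ℝ), ∀ A : testFunctions,
    Function.support (A : ℝ × ℝ × ℝ → ℂ) ⊆ K →
      ∀ b : ℝ, (∀ i ≤ N, ∀ x ∈ quadrant,
          ‖iteratedFDerivWithin ℝ i (A : ℝ × ℝ × ℝ → ℂ) quadrant x‖ ≤ b) →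
        ‖T A‖ ≤ M * b

/-- The oscillatory integral
`J(lam) = ∫_{ℝ × [0,∞)²} exp(-i lam χ₀ (χ₁² - χ₂^{2k})) A(χ₀, χ₁, χ₂) dχ₀ dχ₁ dχ₂`. -/
noncomputable def oscIntegral (k : ℕ) (A : ℝ × ℝ × ℝ → ℂ) (lam : ℝ) : ℂ :=
  ∫ x in quadrant,
    Complex.exp (-Complex.I * ((lam * (x.1 * (x.2.1 ^ 2 - x.2.2 ^ (2 * k))) : ℝ) : ℂ)) * A x

/-- The function `J` has, as `lam → ∞`, the asymptotic expansion
`J(lam) ∼ ∑_{l ≥ 0} c_l lam^{-(l+1)/(2k)} + ∑_{j ≥ 0} d_j lam^{-(j+1)} log lam`: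
for every `n`, after subtraction of all terms whose power of `lam` is `lam^{-n/(2k)}` or larger,
the remainder is `o(lam^{-n/(2k)})`. (The condition `j < n / (2k)`, with the quotient rounded
down, says that `j + 1 ≤ n/(2k)`.) -/
def HasLogExpansion (k : ℕ) (J : ℝ → ℂ) (c d : ℕ → ℂ) : Prop :=
  ∀ n : ℕ,
    (fun lam : ℝ => J lam
        - ∑ l ∈ Finset.range n, c l * ((lam ^ (-(((l : ℝ) + 1) / (2 * (k : ℝ)))) : ℝ) : ℂ)
        - ∑ j ∈ Finset.range (n / (2 * k)),
            d j * ((lam ^ (-((j : ℝ) + 1)) * Real.log lam : ℝ) : ℂ))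
      =o[atTop] fun lam : ℝ => lam ^ (-((n : ℝ) / (2 * (k : ℝ))))

end Hyperbolic

/-! The phase `χ₀ (χ₁² - χ₂^{2k})` is homogeneous of degree one under two scalings: that of `χ₀`
alone, and that of `(χ₁, χ₂)` with weights `1/2` and `1/(2k)`. Consider the integral `F(λ)` of the
exponential against a monomial `χ₀^p χ₁^a χ₂^b` times a derivative of `A`. Integration by parts
along either Euler field gives an equation `λ F' + r F = g`, with `r = p + 1` for the first field
and `r = (k + 1 + ka + b)/(2k)` for the second. Here `g` combines integrals of the same kind with
one more derivative on `A` and one more power of the matching variable (`Jet.euler_fst`,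
`Jet.euler_weighted`). That power kills the boundary term, so `A` need not vanish on the boundary.

The weighted field is applied until `ka + b` is large, then the first field until `p` is large. The
resulting integrals decay to any prescribed order, because `λ χ₀ χ₁²` and `λ χ₀ χ₂^{2k}` times the
exponential are constant multiples of its images under `χ₁ ∂₁` and `χ₂ ∂₂`
(`BoundedJet.exists_decay`). On the way back each Euler equation is solved (`UnifExp.of_euler`). It
contributes `λ^{-r}`, and a new logarithm only if `λ^{-r}` already occurs in `g`. Exponents from one
field never repeat along a chain, so a resonance needs a weighted exponent to meet an integer
exponent of the first field. This happens at most once for each exponent, so logarithms are simple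
and sit at integer powers (`BoundedJet.unifExp_wordOsc`).

All constants are uniform relative to a bound on finitely many derivatives of `A`. The coefficients
are unique (`ExpandsAt.coeff_unique`), so they are linear in `A` and inherit the uniform bounds,
which makes them distributions. -/

namespace Hyperbolic

/-! ### Euler equations and uniform expansions in powers and logarithms -/

section Asymptotics

theorem norm_sub_le_of_norm_deriv_le_rpow {h h' : ℝ → ℂ} {α D : ℝ} (hα : α ≠ 0)
    (hh : ∀ t, 1 ≤ t → HasDerivAt h (h' t) t) (hb : ∀ t, 1 ≤ t → ‖h' t‖ ≤ D * t ^ (α - 1))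
    {a x : ℝ} (ha : 1 ≤ a) (hax : a ≤ x) : ‖h x - h a‖ ≤ D * ((x ^ α - a ^ α) / α) := by
  have key := image_norm_le_of_norm_deriv_right_le_deriv_boundary' (f := fun t => h t - h a)
    (f' := h') (a := a) (b := x) (B := fun t => D * ((t ^ α - a ^ α) / α))
    (B' := fun t => D * t ^ (α - 1)) ?_ ?_ ?_ ?_ ?_ ?_
  · exact key ⟨hax, le_rfl⟩
  · intro t ht
    exact ((hh t (ha.trans ht.1)).continuousAt.sub continuousAt_const).continuousWithinAt
  · intro t ht
    exact ((hh t (ha.trans ht.1)).sub_const _).hasDerivWithinAt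
  · simp
  · intro t ht
    have : t ≠ 0 := by linarith [ht.1]
    exact (((Real.continuousAt_rpow_const t α (Or.inl this)).sub continuousAt_const).div_const
      _ |>.const_mul D).continuousWithinAt
  · intro t ht
    have : t ≠ 0 := by linarith [ht.1]
    have h1 := ((((Real.hasDerivAt_rpow_const (p := α) (Or.inl this)).sub_const
      (a ^ α)).div_const α).const_mul D)
    refine h1.hasDerivWithinAt.congr_deriv ?_
    rw [mul_div_cancel_left₀ _ hα]
  · intro t ht
    exact hb t (ha.trans ht.1)

theorem exists_limit_of_norm_deriv_le_rpow {h h' : ℝ → ℂ} {α D : ℝ} (hα : α < 0) (hD : 0 ≤ D)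
    (hh : ∀ t, 1 ≤ t → HasDerivAt h (h' t) t) (hb : ∀ t, 1 ≤ t → ‖h' t‖ ≤ D * t ^ (α - 1)) :
    ∃ c : ℂ, ∀ t, 1 ≤ t → ‖h t - c‖ ≤ D / (-α) * t ^ α := by
  have hle : ∀ a x : ℝ, 1 ≤ a → a ≤ x → ‖h x - h a‖ ≤ D / (-α) * a ^ α := by
    intro a x ha hax
    refine (norm_sub_le_of_norm_deriv_le_rpow hα.ne hh hb ha hax).trans ?_
    have hx : 0 ≤ x ^ α := Real.rpow_nonneg (by linarith) _
    have : D * ((x ^ α - a ^ α) / α) = D / (-α) * (a ^ α - x ^ α) := by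
      field_simp
      ring
    rw [this]
    have : 0 ≤ D / (-α) := div_nonneg hD (by linarith)
    nlinarith
  have h0 : Tendsto (fun t : ℝ => D / (-α) * t ^ α) atTop (𝓝 0) := by
    have := (tendsto_rpow_neg_atTop (y := -α) (by linarith)).const_mul (D / (-α))
    simpa using this
  have hc : CauchySeq h := by
    rw [Metric.cauchySeq_iff']
    intro ε hε
    obtain ⟨a, ha, ha1⟩ := ((h0.eventually (gt_mem_nhds hε)).and (eventually_ge_atTop 1)).exists
    refine ⟨a, fun x hx => ?_⟩
    rw [dist_eq_norm]
    exact (hle a x ha1 hx).trans_lt ha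
  obtain ⟨c, hc⟩ := cauchySeq_tendsto_of_complete hc
  refine ⟨c, fun t ht => ?_⟩
  rw [norm_sub_rev]
  refine le_of_tendsto ((hc.sub_const (h t)).norm) ?_
  filter_upwards [eventually_ge_atTop t] with x hx using hle t x ht hx

/-- Solutions of an Euler equation `t f' + r f = O(t^{-N})` are multiples of `t^{-r}` up to
`O(t^{-N})`, with uniform constants. -/
theorem exists_euler_coeff {f f' : ℝ → ℂ} {r N D : ℝ} (hN : r ≠ N) (hD : 0 ≤ D)
    (hd : ∀ t, 1 ≤ t → HasDerivAt f (f' t) t)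
    (hb : ∀ t, 1 ≤ t → ‖t * f' t + r * f t‖ ≤ D * t ^ (-N)) (h1 : ‖f 1‖ ≤ D) :
    ∃ c : ℂ, ‖c‖ ≤ (1 + 1 / |r - N|) * D ∧
      ∀ t, 1 ≤ t → ‖f t - c * ((t ^ (-r) : ℝ) : ℂ)‖ ≤ (1 + 1 / |r - N|) * D * t ^ (-N) := by
  -- Integrating factor: `(t^r f)' = t^(r-1) (t f' + r f)`, which is `O(t^(r-N-1))`.
  set h : ℝ → ℂ := fun t => ((t ^ r : ℝ) : ℂ) * f t with hh
  set h' : ℝ → ℂ := fun t => ((t ^ (r - 1) : ℝ) : ℂ) * (t * f' t + r * f t) with hh'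
  have hder : ∀ t, 1 ≤ t → HasDerivAt h (h' t) t := by
    intro t ht
    have ht0 : t ≠ 0 := by linarith
    have e := ((Real.hasDerivAt_rpow_const (p := r) (Or.inl ht0)).ofReal_comp).fun_mul (hd t ht)
    refine e.congr_deriv ?_
    have : t ^ r = t ^ (r - 1) * t := by
      rw [← Real.rpow_add_one ht0]; ring_nf
    simp only [hh', this]
    push_cast
    ring
  have hbound : ∀ t, 1 ≤ t → ‖h' t‖ ≤ D * t ^ (r - N - 1) := by
    intro t ht
    have ht0 : 0 < t := by linarith
    simp only [hh', norm_mul, Complex.norm_real, Real.norm_of_nonneg (Real.rpow_nonneg ht0.le _)]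
    calc t ^ (r - 1) * _ ≤ t ^ (r - 1) * (D * t ^ (-N)) := by gcongr; exact hb t ht
      _ = D * (t ^ (r - 1) * t ^ (-N)) := by ring
      _ = _ := by rw [← Real.rpow_add ht0]; ring_nf
  have hfac : ∀ t, 1 ≤ t → ∀ c : ℂ, ‖f t - c * ((t ^ (-r) : ℝ) : ℂ)‖ = t ^ (-r) * ‖h t - c‖ := by
    intro t ht c
    have ht0 : 0 < t := by linarith
    have e : f t - c * ((t ^ (-r) : ℝ) : ℂ) = ((t ^ (-r) : ℝ) : ℂ) * (h t - c) := by
      simp only [hh, mul_sub, ← mul_assoc, ← Complex.ofReal_mul, ← Real.rpow_add ht0]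
      simp [mul_comm]
    rw [e, norm_mul, Complex.norm_real, Real.norm_of_nonneg (Real.rpow_nonneg ht0.le _)]
  have hone : h 1 = f 1 := by simp [hh]
  have hexp : ∀ t : ℝ, 1 ≤ t → t ^ (-r) * t ^ (r - N) = t ^ (-N) := by
    intro t ht
    rw [← Real.rpow_add (by linarith)]; ring_nf
  -- For `r < N` the derivative of `h` is integrable at infinity and `c` is the limit of `h`. For `r
  -- > N` the function `t^{-r}` is itself `O(t^{-N})`, so `c = 0` serves.
  rcases lt_or_gt_of_ne hN with hlt | hgt
  · have habs : |r - N| = -(r - N) := abs_of_neg (by linarith)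
    obtain ⟨c, hc⟩ := exists_limit_of_norm_deriv_le_rpow (by linarith : r - N < 0) hD hder hbound
    have hpos : 0 < -(r - N) := by linarith
    refine ⟨c, ?_, fun t ht => ?_⟩
    · have h2 := hc 1 le_rfl
      rw [hone, Real.one_rpow, mul_one] at h2
      calc ‖c‖ = ‖f 1 - (f 1 - c)‖ := by ring_nf
        _ ≤ ‖f 1‖ + ‖f 1 - c‖ := norm_sub_le _ _
        _ ≤ D + D / (-(r - N)) := add_le_add h1 h2
        _ = _ := by rw [habs]; ring
    · rw [hfac t ht]
      have ht0 : 0 < t := by linarith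
      calc t ^ (-r) * ‖h t - c‖ ≤ t ^ (-r) * (D / (-(r - N)) * t ^ (r - N)) := by
            gcongr; exact hc t ht
        _ = D / (-(r - N)) * t ^ (-N) := by rw [← hexp t ht]; ring
        _ ≤ _ := by
            gcongr
            rw [habs, add_mul, one_mul, one_div, ← div_eq_inv_mul]
            linarith
  · have habs : |r - N| = r - N := abs_of_pos (by linarith)
    have hpos : 0 < r - N := by linarith
    refine ⟨0, by rw [norm_zero]; positivity, fun t ht => ?_⟩
    have ht0 : 0 < t := by linarith
    rw [hfac t ht, sub_zero]
    have h2 := norm_sub_le_of_norm_deriv_le_rpow hpos.ne' hder hbound le_rfl ht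
    rw [hone, Real.one_rpow] at h2
    have h3 : 1 ≤ t ^ (r - N) := Real.one_le_rpow ht hpos.le
    have h4 : ‖h t‖ ≤ (1 + 1 / (r - N)) * D * t ^ (r - N) := by
      calc ‖h t‖ = ‖f 1 + (h t - f 1)‖ := by ring_nf
        _ ≤ ‖f 1‖ + ‖h t - f 1‖ := norm_add_le _ _
        _ ≤ D + D * ((t ^ (r - N) - 1) / (r - N)) := add_le_add h1 h2
        _ ≤ D * t ^ (r - N) + D * (t ^ (r - N) / (r - N)) := by
            gcongr
            · exact le_mul_of_one_le_right hD h3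
            · linarith
        _ = _ := by ring
    calc t ^ (-r) * ‖h t‖ ≤ t ^ (-r) * ((1 + 1 / (r - N)) * D * t ^ (r - N)) := by gcongr
      _ = (1 + 1 / (r - N)) * D * t ^ (-N) := by rw [← hexp t ht]; ring
      _ = _ := by rw [habs]

/-- A family `f i` has, with constants uniform relative to the weights `w i`, an expansion in the
functions `t^{-s}`, `s ∈ S`, and `t^{-s} log t`, `s ∈ L`, up to `O(t^{-N})`. -/
def UnifExp {ι : Type*} (w : ι → ℝ) (S L : Finset ℝ) (N : ℝ) (f : ι → ℝ → ℂ) : Prop :=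
  ∃ (c d : ι → ℝ → ℂ) (C : ℝ), 0 ≤ C ∧ ∀ i, (∀ s, ‖c i s‖ ≤ C * w i) ∧ (∀ s, ‖d i s‖ ≤ C * w i) ∧
    ∀ t : ℝ, 1 ≤ t → ‖f i t - ∑ s ∈ S, c i s * ((t ^ (-s) : ℝ) : ℂ)
      - ∑ s ∈ L, d i s * ((t ^ (-s) * Real.log t : ℝ) : ℂ)‖ ≤ C * w i * t ^ (-N)

namespace UnifExp

variable {ι : Type*} {w : ι → ℝ} {S L S' L' : Finset ℝ} {N : ℝ} {f g : ι → ℝ → ℂ}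

theorem mono (hw : ∀ i, 0 ≤ w i) (h : UnifExp w S L N f) (hS : S ⊆ S') (hL : L ⊆ L') :
    UnifExp w S' L' N f := by
  obtain ⟨c, d, C, hC, h⟩ := h
  refine ⟨fun i s => if s ∈ S then c i s else 0, fun i s => if s ∈ L then d i s else 0, C, hC,
    fun i => ⟨fun s => ?_, fun s => ?_, fun t ht => ?_⟩⟩
  · beta_reduce
    split_ifs
    · exact (h i).1 s
    · rw [norm_zero]; exact mul_nonneg hC (hw i)
  · beta_reduce
    split_ifs
    · exact (h i).2.1 s
    · rw [norm_zero]; exact mul_nonneg hC (hw i)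
  · have h1 := (h i).2.2 t ht
    simp only [ite_mul, zero_mul, Finset.sum_ite_mem]
    rwa [Finset.inter_eq_right.2 hS, Finset.inter_eq_right.2 hL]

theorem congr (h : UnifExp w S L N f) (hfg : ∀ i t, f i t = g i t) : UnifExp w S L N g := by
  rwa [show g = f from funext fun i => funext fun t => (hfg i t).symm]

theorem add (hf : UnifExp w S L N f) (hg : UnifExp w S L N g) :
    UnifExp w S L N (fun i t => f i t + g i t) := by
  obtain ⟨c, d, C, hC, h⟩ := hf
  obtain ⟨c', d', C', hC', h'⟩ := hg
  refine ⟨fun i s => c i s + c' i s, fun i s => d i s + d' i s, C + C', add_nonneg hC hC',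
    fun i => ⟨fun s => ?_, fun s => ?_, fun t ht => ?_⟩⟩
  · rw [add_mul]; exact norm_add_le_of_le ((h i).1 s) ((h' i).1 s)
  · rw [add_mul]; exact norm_add_le_of_le ((h i).2.1 s) ((h' i).2.1 s)
  · rw [add_mul C, add_mul]
    refine le_of_eq_of_le (congrArg norm ?_) (norm_add_le_of_le ((h i).2.2 t ht) ((h' i).2.2 t ht))
    simp only [add_mul, Finset.sum_add_distrib]
    ring

theorem const_mul (a : ℂ) (hf : UnifExp w S L N f) :
    UnifExp w S L N (fun i t => a * f i t) := by
  obtain ⟨c, d, C, hC, h⟩ := hf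
  refine ⟨fun i s => a * c i s, fun i s => a * d i s, ‖a‖ * C, by positivity,
    fun i => ⟨fun s => ?_, fun s => ?_, fun t ht => ?_⟩⟩
  · rw [norm_mul, mul_assoc]; gcongr; exact (h i).1 s
  · rw [norm_mul, mul_assoc]; gcongr; exact (h i).2.1 s
  · have e : a * f i t - ∑ s ∈ S, a * c i s * ((t ^ (-s) : ℝ) : ℂ)
        - ∑ s ∈ L, a * d i s * ((t ^ (-s) * Real.log t : ℝ) : ℂ)
        = a * (f i t - ∑ s ∈ S, c i s * ((t ^ (-s) : ℝ) : ℂ)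
        - ∑ s ∈ L, d i s * ((t ^ (-s) * Real.log t : ℝ) : ℂ)) := by
      simp only [mul_sub, Finset.mul_sum, mul_assoc]
    rw [e, norm_mul, mul_assoc, mul_assoc, ← mul_assoc C]
    gcongr
    exact (h i).2.2 t ht

theorem of_norm_le {C : ℝ} (hw : ∀ i, 0 ≤ w i) (hC : 0 ≤ C)
    (h : ∀ i t, 1 ≤ t → ‖f i t‖ ≤ C * w i * t ^ (-N)) : UnifExp w S L N f := by
  refine ⟨0, 0, C, hC, fun i => ⟨fun s => ?_, fun s => ?_, fun t ht => ?_⟩⟩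
  · simpa using mul_nonneg hC (hw i)
  · simpa using mul_nonneg hC (hw i)
  · simpa using h i t ht

theorem sum (hw : ∀ i, 0 ≤ w i) {κ : Type*} (T : Finset κ) {F : κ → ι → ℝ → ℂ}
    (h : ∀ s ∈ T, UnifExp w S L N (F s)) : UnifExp w S L N (fun i t => ∑ s ∈ T, F s i t) := by
  classical
  induction T using Finset.induction_on with
  | empty => exact of_norm_le hw le_rfl (by simp)
  | insert a T ha ih =>
    simp only [Finset.sum_insert ha]
    exact (h a (Finset.mem_insert_self _ _)).add
      (ih fun s hs => h s (Finset.mem_insert_of_mem hs))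

theorem monomial (hw : ∀ i, 0 ≤ w i) {c : ι → ℂ} {C : ℝ} (hC : 0 ≤ C) (hc : ∀ i, ‖c i‖ ≤ C * w i)
    {s : ℝ} (hs : s ∈ S) : UnifExp w S L N (fun i t => c i * ((t ^ (-s) : ℝ) : ℂ)) := by
  refine mono hw (S := {s}) (L := ∅) ?_ (by simpa using hs) (by simp)
  refine ⟨fun i _ => c i, 0, C, hC, fun i => ⟨fun _ => hc i, fun _ => ?_, fun t ht => ?_⟩⟩
  · simpa using mul_nonneg hC (hw i)
  · have : 0 ≤ t ^ (-N) := Real.rpow_nonneg (by linarith) _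
    simpa using mul_nonneg (mul_nonneg hC (hw i)) this

theorem monomial_log (hw : ∀ i, 0 ≤ w i) {c : ι → ℂ} {C : ℝ} (hC : 0 ≤ C)
    (hc : ∀ i, ‖c i‖ ≤ C * w i) {s : ℝ} (hs : s ∈ L) :
    UnifExp w S L N (fun i t => c i * ((t ^ (-s) * Real.log t : ℝ) : ℂ)) := by
  refine mono hw (S := ∅) (L := {s}) ?_ (by simp) (by simpa using hs)
  refine ⟨0, fun i _ => c i, C, hC, fun i => ⟨fun _ => ?_, fun _ => hc i, fun t ht => ?_⟩⟩
  · simpa using mul_nonneg hC (hw i)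
  · have : 0 ≤ t ^ (-N) := Real.rpow_nonneg (by linarith) _
    simpa using mul_nonneg (mul_nonneg hC (hw i)) this

theorem norm_one_le (hf : UnifExp w S L N f) : ∃ C, 0 ≤ C ∧ ∀ i, ‖f i 1‖ ≤ C * w i := by
  obtain ⟨c, d, C, hC, h⟩ := hf
  refine ⟨C + S.card * C, by positivity, fun i => ?_⟩
  have h1 := (h i).2.2 1 le_rfl
  simp only [Real.one_rpow, Real.log_one, mul_zero, Complex.ofReal_zero, Complex.ofReal_one,
    mul_one, Finset.sum_const_zero, sub_zero] at h1
  have h2 : ‖∑ s ∈ S, c i s‖ ≤ S.card * (C * w i) := by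
    refine (norm_sum_le _ _).trans ((Finset.sum_le_sum fun s _ => (h i).1 s).trans ?_)
    simp
  calc ‖f i 1‖ = ‖(f i 1 - ∑ s ∈ S, c i s) + ∑ s ∈ S, c i s‖ := by ring_nf
    _ ≤ C * w i + S.card * (C * w i) := norm_add_le_of_le h1 h2
    _ = _ := by ring

end UnifExp

theorem hasDerivAt_rpow_neg {s t : ℝ} (ht : t ≠ 0) :
    HasDerivAt (fun t : ℝ => t ^ (-s)) (-s * t ^ (-s) / t) t := by
  convert Real.hasDerivAt_rpow_const (p := -s) (Or.inl ht) using 1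
  rw [Real.rpow_sub_one ht]
  ring

theorem hasDerivAt_rpow_neg_mul_log {s t : ℝ} (ht : t ≠ 0) :
    HasDerivAt (fun t : ℝ => t ^ (-s) * Real.log t)
      ((-s * (t ^ (-s) * Real.log t) + t ^ (-s)) / t) t := by
  refine ((hasDerivAt_rpow_neg ht).fun_mul (Real.hasDerivAt_log ht)).congr_deriv ?_
  ring

/-- A solution of `t u' + r u = t^{-s}`. -/
noncomputable def eulerPow (r s t : ℝ) : ℝ :=
  if s = r then t ^ (-s) * Real.log t else (r - s)⁻¹ * t ^ (-s)

/-- A solution of `t u' + r u = t^{-s} log t`, for `s ≠ r`. -/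
noncomputable def eulerLog (r s t : ℝ) : ℝ :=
  (r - s)⁻¹ * (t ^ (-s) * Real.log t) - ((r - s) ^ 2)⁻¹ * t ^ (-s)

theorem hasDerivAt_eulerPow (r s : ℝ) {t : ℝ} (ht : t ≠ 0) :
    HasDerivAt (eulerPow r s) ((t ^ (-s) - r * eulerPow r s t) / t) t := by
  by_cases h : s = r
  · subst h
    have : eulerPow s s = fun t => t ^ (-s) * Real.log t := by ext; simp [eulerPow]
    rw [this]
    convert hasDerivAt_rpow_neg_mul_log (s := s) ht using 1
    ring
  · have h' : r - s ≠ 0 := sub_ne_zero.2 (Ne.symm h)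
    have : eulerPow r s = fun t => (r - s)⁻¹ * t ^ (-s) := by ext; simp [eulerPow, h]
    rw [this]
    refine ((hasDerivAt_rpow_neg (s := s) ht).const_mul (r - s)⁻¹).congr_deriv ?_
    field_simp
    ring

theorem hasDerivAt_eulerLog {r s : ℝ} (h : s ≠ r) {t : ℝ} (ht : t ≠ 0) :
    HasDerivAt (eulerLog r s) ((t ^ (-s) * Real.log t - r * eulerLog r s t) / t) t := by
  have h' : r - s ≠ 0 := sub_ne_zero.2 (Ne.symm h)
  refine (((hasDerivAt_rpow_neg_mul_log (s := s) ht).const_mul (r - s)⁻¹).fun_sub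
    ((hasDerivAt_rpow_neg (s := s) ht).const_mul ((r - s) ^ 2)⁻¹)).congr_deriv ?_
  simp only [eulerLog]
  field_simp
  ring

/-- Subtracting the explicit solutions `eulerPow` and `eulerLog` leaves an Euler equation with right
side `O(t^{-N})`, whose solution is a multiple of `t^{-r}` up to that error. A logarithm is created
only by the resonance `r ∈ S`; the condition `r ∉ L` excludes squared logarithms. -/
theorem UnifExp.of_euler {ι : Type*} {w : ι → ℝ} {S L : Finset ℝ} {N r : ℝ} {f f' : ι → ℝ → ℂ}
    (hw : ∀ i, 0 ≤ w i) (hr : r ∉ L) (hN : r ≠ N)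
    (hd : ∀ i t, 1 ≤ t → HasDerivAt (f i) (f' i t) t)
    (h1 : ∃ C, 0 ≤ C ∧ ∀ i, ‖f i 1‖ ≤ C * w i)
    (hg : UnifExp w S L N (fun i t => t * f' i t + r * f i t)) :
    UnifExp w (S ∪ L ∪ {r}) (L ∪ (S ∩ {r})) N f := by
  obtain ⟨c, d, C, hC, h⟩ := hg
  obtain ⟨C₁, hC₁, h1⟩ := h1
  set u : ι → ℝ → ℂ := fun i t => ∑ s ∈ S, c i s * ((eulerPow r s t : ℝ) : ℂ)
    + ∑ s ∈ L, d i s * ((eulerLog r s t : ℝ) : ℂ) with hu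
  have hLr : ∀ s ∈ L, s ≠ r := fun s hs e => hr (e ▸ hs)
  have hue : UnifExp w (S ∪ L ∪ {r}) (L ∪ (S ∩ {r})) N u := by
    refine .add (.sum hw _ fun s hs => ?_) (.sum hw _ fun s hs => ?_)
    · by_cases e : s = r
      · simp only [eulerPow, e, if_true]
        refine .monomial_log hw hC (fun i => (h i).1 r) ?_
        subst e
        simp [hs]
      · simp only [eulerPow, e, if_false, Complex.ofReal_mul]
        have := (UnifExp.monomial (S := S ∪ L ∪ {r}) (L := L ∪ (S ∩ {r})) (N := N) hw hC
          (fun i => (h i).1 s) (s := s) (by simp [hs])).const_mul (((r - s)⁻¹ : ℝ) : ℂ)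
        convert this using 3
        ring
    · have h1 := (UnifExp.monomial_log (S := S ∪ L ∪ {r}) (L := L ∪ (S ∩ {r})) (N := N) hw hC
          (fun i => (h i).2.1 s) (s := s) (by simp [hs])).const_mul (((r - s)⁻¹ : ℝ) : ℂ)
      have h2 := (UnifExp.monomial (S := S ∪ L ∪ {r}) (L := L ∪ (S ∩ {r})) (N := N) hw hC
          (fun i => (h i).2.1 s) (s := s) (by simp [hs])).const_mul
            (-((((r - s) ^ 2)⁻¹ : ℝ) : ℂ))
      convert h1.add h2 using 3
      simp only [eulerLog]
      push_cast
      ring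
  obtain ⟨C₂, hC₂, h2⟩ := hue.norm_one_le
  set u' : ι → ℝ → ℂ := fun i t =>
    ∑ s ∈ S, c i s * (((t ^ (-s) - r * eulerPow r s t) / t : ℝ) : ℂ)
    + ∑ s ∈ L, d i s * (((t ^ (-s) * Real.log t - r * eulerLog r s t) / t : ℝ) : ℂ) with hu'
  have hud : ∀ i t, 1 ≤ t → HasDerivAt (u i) (u' i t) t := by
    intro i t ht
    have ht0 : t ≠ 0 := by linarith
    exact (HasDerivAt.fun_sum fun s _ =>
        ((hasDerivAt_eulerPow r s ht0).ofReal_comp.const_mul (c i s))).add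
      (HasDerivAt.fun_sum fun s hs =>
        ((hasDerivAt_eulerLog (hLr s hs) ht0).ofReal_comp.const_mul (d i s)))
  have heul : ∀ (i : ι) (t : ℝ), 1 ≤ t → (t : ℂ) * u' i t + r * u i t
      = ∑ s ∈ S, c i s * ((t ^ (-s) : ℝ) : ℂ)
        + ∑ s ∈ L, d i s * ((t ^ (-s) * Real.log t : ℝ) : ℂ) := by
    intro i t ht
    have ht0 : (t : ℂ) ≠ 0 := by
      have : t ≠ 0 := by linarith
      exact_mod_cast this
    simp only [hu, hu', mul_add, Finset.mul_sum]
    rw [add_add_add_comm, ← Finset.sum_add_distrib, ← Finset.sum_add_distrib]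
    congr 1
    · refine Finset.sum_congr rfl fun s _ => ?_
      push_cast
      field_simp
      ring
    · refine Finset.sum_congr rfl fun s _ => ?_
      push_cast
      field_simp
      ring
  have hmain : ∀ i, ∃ a : ℂ, ‖a‖ ≤ (1 + 1 / |r - N|) * ((C + C₁ + C₂) * w i) ∧
      ∀ t, 1 ≤ t → ‖(f i t - u i t) - a * ((t ^ (-r) : ℝ) : ℂ)‖
        ≤ (1 + 1 / |r - N|) * ((C + C₁ + C₂) * w i) * t ^ (-N) := by
    intro i
    have hwi := hw i
    refine exists_euler_coeff (f := fun t => f i t - u i t) (f' := fun t => f' i t - u' i t)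
      hN (by positivity) (fun t ht => (hd i t ht).sub (hud i t ht)) (fun t ht => ?_) ?_
    · have e : (t : ℂ) * (f' i t - u' i t) + r * (f i t - u i t)
          = (t * f' i t + r * f i t) - ∑ s ∈ S, c i s * ((t ^ (-s) : ℝ) : ℂ)
            - ∑ s ∈ L, d i s * ((t ^ (-s) * Real.log t : ℝ) : ℂ) := by
        linear_combination -heul i t ht
      rw [e]
      refine ((h i).2.2 t ht).trans ?_
      have : 0 ≤ t ^ (-N) := Real.rpow_nonneg (by linarith) _
      gcongr
      linarith
    · refine (norm_sub_le_of_le (h1 i) (h2 i)).trans ?_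
      rw [← add_mul]
      gcongr
      linarith
  choose a ha ha' using hmain
  have hh : UnifExp w (S ∪ L ∪ {r}) (L ∪ (S ∩ {r})) N (fun i t => f i t - u i t) := by
    have e1 : UnifExp w (S ∪ L ∪ {r}) (L ∪ (S ∩ {r})) N
        (fun i t => (f i t - u i t) - a i * ((t ^ (-r) : ℝ) : ℂ)) :=
      .of_norm_le (C := (1 + 1 / |r - N|) * (C + C₁ + C₂)) hw (by positivity)
        fun i t ht => (ha' i t ht).trans (by rw [mul_assoc (1 + 1 / |r - N|) (C + C₁ + C₂)])
    have e2 : UnifExp w (S ∪ L ∪ {r}) (L ∪ (S ∩ {r})) N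
        (fun i t => a i * ((t ^ (-r) : ℝ) : ℂ)) :=
      .monomial (C := (1 + 1 / |r - N|) * (C + C₁ + C₂)) hw (by positivity)
        (fun i => (ha i).trans (by rw [mul_assoc (1 + 1 / |r - N|)])) (by simp)
    convert e1.add e2 using 3
    ring
  simpa using hh.add hue

end Asymptotics

/-! ### Integration by parts in the oscillatory integrals -/

section OscillatoryIntegrals

/-- The interior `ℝ × (0,∞) × (0,∞)` of the domain. -/
def openQuadrant : Set (ℝ × ℝ × ℝ) := univ ×ˢ (Ioi 0 ×ˢ Ioi 0)

theorem isOpen_openQuadrant : IsOpen openQuadrant := isOpen_univ.prod (isOpen_Ioi.prod isOpen_Ioi)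

theorem mem_openQuadrant {t x y : ℝ} : (t, x, y) ∈ openQuadrant ↔ 0 < x ∧ 0 < y := by
  simp [openQuadrant]

theorem openQuadrant_nonempty : openQuadrant.Nonempty :=
  ⟨(0, 1, 1), mem_openQuadrant.2 ⟨one_pos, one_pos⟩⟩

theorem integrableOn_and_norm_integral_le {f : ℝ × ℝ × ℝ → ℂ} {M R : ℝ}
    (hc : ContinuousOn f openQuadrant) (hM : ∀ z ∈ openQuadrant, ‖f z‖ ≤ M)
    (h0 : ∀ z ∈ openQuadrant, R < ‖z‖ → f z = 0) :
    IntegrableOn f openQuadrant ∧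
      ‖∫ z in openQuadrant, f z‖ ≤ M * volume.real (Metric.closedBall (0 : ℝ × ℝ × ℝ) R) := by
  have hM0 : 0 ≤ M := by
    obtain ⟨z, hz⟩ := openQuadrant_nonempty
    exact (norm_nonneg _).trans (hM z hz)
  set g : ℝ × ℝ × ℝ → ℝ := (Metric.closedBall (0 : ℝ × ℝ × ℝ) R).indicator fun _ => M with hg
  have hgi : Integrable g := by
    rw [hg, integrable_indicator_iff Metric.isClosed_closedBall.measurableSet]
    exact integrableOn_const (isCompact_closedBall _ _).measure_lt_top.ne
  have hg0 : ∀ z, 0 ≤ g z := fun z => indicator_nonneg (fun _ _ => hM0) z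
  have hfg : ∀ᵐ z ∂volume.restrict openQuadrant, ‖f z‖ ≤ g z := by
    refine ae_restrict_of_forall_mem isOpen_openQuadrant.measurableSet fun z hz => ?_
    by_cases hzR : R < ‖z‖
    · rw [h0 z hz hzR, norm_zero]; exact hg0 z
    · have : z ∈ Metric.closedBall (0 : ℝ × ℝ × ℝ) R := by simpa using hzR
      rw [hg, indicator_of_mem this]
      exact hM z hz
  refine ⟨hgi.restrict.mono' (hc.aestronglyMeasurable isOpen_openQuadrant.measurableSet) hfg, ?_⟩
  refine (norm_integral_le_of_norm_le hgi.restrict hfg).trans ?_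
  refine (setIntegral_le_integral hgi (Eventually.of_forall hg0)).trans ?_
  rw [hg, integral_indicator Metric.isClosed_closedBall.measurableSet, setIntegral_const,
    smul_eq_mul, mul_comm]

/-- Fubini settles the integrable case; otherwise the integral is zero by convention. Hence no
integrability has to be checked. -/
theorem integral_Ioi_prod_eq_zero_left {g : ℝ × ℝ → ℂ}
    (h : ∀ y, 0 < y → ∫ x in Ioi (0 : ℝ), g (x, y) = 0) :
    ∫ q in Ioi (0 : ℝ) ×ˢ Ioi (0 : ℝ), g q = 0 := by
  rw [Measure.volume_eq_prod, ← Measure.prod_restrict]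
  by_cases hi : Integrable g ((volume.restrict (Ioi 0)).prod (volume.restrict (Ioi 0)))
  · rw [integral_prod_symm _ hi]
    exact setIntegral_eq_zero_of_forall_eq_zero h
  · exact integral_undef hi

theorem integral_Ioi_prod_eq_zero_right {g : ℝ × ℝ → ℂ}
    (h : ∀ x, 0 < x → ∫ y in Ioi (0 : ℝ), g (x, y) = 0) :
    ∫ q in Ioi (0 : ℝ) ×ˢ Ioi (0 : ℝ), g q = 0 := by
  rw [Measure.volume_eq_prod, ← Measure.prod_restrict]
  by_cases hi : Integrable g ((volume.restrict (Ioi 0)).prod (volume.restrict (Ioi 0)))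
  · rw [integral_prod _ hi]
    exact setIntegral_eq_zero_of_forall_eq_zero h
  · exact integral_undef hi

theorem restrict_openQuadrant : (volume : Measure (ℝ × ℝ × ℝ)).restrict openQuadrant
    = (volume : Measure ℝ).prod (volume.restrict (Ioi 0 ×ˢ Ioi 0)) := by
  rw [openQuadrant, Measure.volume_eq_prod, ← Measure.prod_restrict, Measure.restrict_univ]

theorem integral_openQuadrant_eq_zero {h : ℝ × ℝ × ℝ → ℂ}
    (hh : ∀ t, ∫ q in Ioi (0 : ℝ) ×ˢ Ioi (0 : ℝ), h (t, q) = 0) :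
    ∫ z in openQuadrant, h z = 0 := by
  rw [restrict_openQuadrant]
  by_cases hi : Integrable h ((volume : Measure ℝ).prod (volume.restrict (Ioi 0 ×ˢ Ioi 0)))
  · rw [integral_prod _ hi]
    simp [hh]
  · exact integral_undef hi

theorem integral_openQuadrant_eq_zero_of_fst {h : ℝ × ℝ × ℝ → ℂ}
    (hh : ∀ x y, 0 < x → 0 < y → ∫ t, h (t, x, y) = 0) :
    ∫ z in openQuadrant, h z = 0 := by
  rw [restrict_openQuadrant]
  by_cases hi : Integrable h ((volume : Measure ℝ).prod (volume.restrict (Ioi 0 ×ˢ Ioi 0)))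
  · rw [integral_prod_symm _ hi]
    exact setIntegral_eq_zero_of_forall_eq_zero fun q hq => hh q.1 q.2 hq.1 hq.2
  · exact integral_undef hi

theorem integral_deriv_eq_zero {H H' : ℝ → ℂ} {R : ℝ} (hd : ∀ t, HasDerivAt H (H' t) t)
    (h0 : ∀ t, R < |t| → H t = 0) : ∫ t, H' t = 0 := by
  by_cases hi : Integrable H'
  · rw [integral_of_hasDerivAt_of_tendsto (m := 0) (n := 0) hd hi, sub_zero]
    · refine tendsto_const_nhds.congr' ?_
      filter_upwards [eventually_lt_atBot (-R)] with t ht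
      exact (h0 t (lt_of_lt_of_le (by linarith) (neg_le_abs t))).symm
    · refine tendsto_const_nhds.congr' ?_
      filter_upwards [eventually_gt_atTop R] with t ht
      exact (h0 t (lt_of_lt_of_le ht (le_abs_self t))).symm
  · exact integral_undef hi

/-- The bound by `x^(a+1)` makes `H` continuous at the end point with value zero, so neither end
contributes. No regularity of the amplitude at the boundary is used. -/
theorem integral_Ioi_deriv_eq_zero {H H' : ℝ → ℂ} {R C : ℝ} {a : ℕ}
    (hd : ∀ x, 0 < x → HasDerivAt H (H' x) x) (hz : H 0 = 0)
    (hb : ∀ x, 0 < x → ‖H x‖ ≤ C * x ^ (a + 1))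
    (h0 : ∀ x, 0 < x → R < |x| → H x = 0) : ∫ x in Ioi (0 : ℝ), H' x = 0 := by
  by_cases hi : IntegrableOn H' (Ioi 0)
  · rw [integral_Ioi_of_hasDerivAt_of_tendsto (m := 0) ?_ hd hi, hz, sub_zero]
    · refine tendsto_const_nhds.congr' ?_
      filter_upwards [eventually_gt_atTop R, eventually_gt_atTop 0] with t ht ht0
      exact (h0 t ht0 (lt_of_lt_of_le ht (le_abs_self t))).symm
    · rw [ContinuousWithinAt, hz]
      have hC : Tendsto (fun x : ℝ => C * x ^ (a + 1)) (𝓝[≥] 0) (𝓝 0) := by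
        have : Continuous fun x : ℝ => C * x ^ (a + 1) := by fun_prop
        simpa using (this.tendsto 0).mono_left (nhdsWithin_le_nhds (s := Ici 0))
      refine squeeze_zero_norm' ?_ hC
      filter_upwards [self_mem_nhdsWithin] with x hx
      rcases (mem_Ici.1 hx).eq_or_lt with rfl | hx
      · simp [hz]
      · exact hb x hx
  · exact integral_undef hi

theorem integral_mul_add_mul_add {α : Type*} [MeasurableSpace α] {μ : Measure α} {f g h : α → ℂ}
    {c d : ℂ} (hf : Integrable f μ) (hg : Integrable g μ) (hh : Integrable h μ) :
    ∫ z, (c * f z + d * g z + h z) ∂μ = c * ∫ z, f z ∂μ + d * ∫ z, g z ∂μ + ∫ z, h z ∂μ := by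
  rw [integral_add (f := fun z => c * f z + d * g z) ((hf.const_mul c).add (hg.const_mul d)) hh,
    integral_add (hf.const_mul c) (hg.const_mul d), integral_const_mul, integral_const_mul]

/-- A family of functions on the open domain, indexed by words in the three coordinates, closed
under the partial derivatives, bounded, and vanishing outside the ball of radius `R`. -/
structure Jet (R : ℝ) where
  nonneg : 0 ≤ R
  G : List (Fin 3) → ℝ × ℝ × ℝ → ℂ
  continuousOn : ∀ w, ContinuousOn (G w) openQuadrant
  eq_zero : ∀ w, ∀ z ∈ openQuadrant, R < ‖z‖ → G w z = 0
  bdd : ∀ w, ∃ M, ∀ z ∈ openQuadrant, ‖G w z‖ ≤ M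
  deriv₀ : ∀ w t x y, 0 < x → 0 < y →
    HasDerivAt (fun t => G w (t, x, y)) (G (0 :: w) (t, x, y)) t
  deriv₁ : ∀ w t x y, 0 < x → 0 < y →
    HasDerivAt (fun x => G w (t, x, y)) (G (1 :: w) (t, x, y)) x
  deriv₂ : ∀ w t x y, 0 < x → 0 < y →
    HasDerivAt (fun y => G w (t, x, y)) (G (2 :: w) (t, x, y)) y

/-- The oscillating factor. -/
noncomputable def wave (k : ℕ) (lam : ℝ) (z : ℝ × ℝ × ℝ) : ℂ :=
  Complex.exp (-Complex.I * ((lam * (z.1 * (z.2.1 ^ 2 - z.2.2 ^ (2 * k))) : ℝ) : ℂ))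

theorem norm_wave (k : ℕ) (lam : ℝ) (z : ℝ × ℝ × ℝ) : ‖wave k lam z‖ = 1 := by
  rw [wave, neg_mul, mul_comm, ← neg_mul, ← Complex.ofReal_neg, Complex.norm_exp_ofReal_mul_I]

theorem continuous_wave (k : ℕ) (lam : ℝ) : Continuous (wave k lam) := by
  unfold wave
  fun_prop

theorem hasDerivAt_wave_comp (k : ℕ) (lam : ℝ) {γ : ℝ → ℝ × ℝ × ℝ} {s v : ℝ}
    (h : HasDerivAt (fun s => (γ s).1 * ((γ s).2.1 ^ 2 - (γ s).2.2 ^ (2 * k))) v s) :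
    HasDerivAt (fun s => wave k lam (γ s)) (-Complex.I * lam * v * wave k lam (γ s)) s := by
  refine (((h.const_mul lam).ofReal_comp.const_mul (-Complex.I)).cexp).congr_deriv ?_
  simp only [wave]
  push_cast
  ring

/-- A monomial in the three coordinates, with complex values. -/
def mono (p a b : ℕ) (z : ℝ × ℝ × ℝ) : ℂ := (z.1 : ℂ) ^ p * (z.2.1 : ℂ) ^ a * (z.2.2 : ℂ) ^ b

theorem continuous_mono (p a b : ℕ) : Continuous (mono p a b) := by
  unfold mono
  fun_prop

theorem norm_mono_le {R : ℝ} (p a b : ℕ) {z : ℝ × ℝ × ℝ} (hz : ‖z‖ ≤ R) :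
    ‖mono p a b z‖ ≤ R ^ (p + a + b) := by
  have h1 : ‖z.1‖ ≤ R := (norm_fst_le z).trans hz
  have h2 : ‖z.2.1‖ ≤ R := (norm_fst_le z.2).trans ((norm_snd_le z).trans hz)
  have h3 : ‖z.2.2‖ ≤ R := (norm_snd_le z.2).trans ((norm_snd_le z).trans hz)
  have hR : 0 ≤ R := (norm_nonneg _).trans hz
  simp only [mono, norm_mul, norm_pow, Complex.norm_real, pow_add]
  gcongr

namespace Jet

variable {R : ℝ} (J : Jet R) (k : ℕ)

/-- The integrand of the oscillatory integral with a monomial factor and the derivative of the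
amplitude given by the word `w`. -/
noncomputable def integrand (p a b : ℕ) (w : List (Fin 3)) (lam : ℝ) (z : ℝ × ℝ × ℝ) : ℂ :=
  wave k lam z * mono p a b z * J.G w z

/-- The oscillatory integral with a monomial factor and the derivative of the amplitude given by
the word `w`. -/
noncomputable def osc (p a b : ℕ) (w : List (Fin 3)) (lam : ℝ) : ℂ :=
  ∫ z in openQuadrant, J.integrand k p a b w lam z

variable (p a b : ℕ) (w : List (Fin 3)) (lam : ℝ)

theorem continuousOn_integrand : ContinuousOn (J.integrand k p a b w lam) openQuadrant :=
  ((continuous_wave k lam).continuousOn.mul (continuous_mono p a b).continuousOn).mul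
    (J.continuousOn w)

theorem integrand_eq_zero {z : ℝ × ℝ × ℝ} (hz : z ∈ openQuadrant) (hR : R < ‖z‖) :
    J.integrand k p a b w lam z = 0 := by
  rw [integrand, J.eq_zero w z hz hR, mul_zero]

theorem norm_integrand_le {M : ℝ} (hM : ∀ z ∈ openQuadrant, ‖J.G w z‖ ≤ M) {z : ℝ × ℝ × ℝ}
    (hz : z ∈ openQuadrant) : ‖J.integrand k p a b w lam z‖ ≤ R ^ (p + a + b) * M := by
  have hR := J.nonneg
  have hM0 : 0 ≤ M := (norm_nonneg _).trans (hM z hz)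
  rcases lt_or_ge R ‖z‖ with h | h
  · rw [J.integrand_eq_zero k p a b w lam hz h, norm_zero]
    positivity
  · rw [integrand, norm_mul, norm_mul, norm_wave, one_mul]
    gcongr
    · exact norm_mono_le p a b h
    · exact hM z hz

theorem integrableOn_integrand : IntegrableOn (J.integrand k p a b w lam) openQuadrant := by
  obtain ⟨M, hM⟩ := J.bdd w
  exact (integrableOn_and_norm_integral_le (J.continuousOn_integrand k p a b w lam)
    (fun _ hz => J.norm_integrand_le k p a b w lam hM hz)
    (fun _ hz h => J.integrand_eq_zero k p a b w lam hz h)).1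

theorem norm_osc_le {M : ℝ} (hM : ∀ z ∈ openQuadrant, ‖J.G w z‖ ≤ M) :
    ‖J.osc k p a b w lam‖
      ≤ R ^ (p + a + b) * M * volume.real (Metric.closedBall (0 : ℝ × ℝ × ℝ) R) :=
  (integrableOn_and_norm_integral_le (J.continuousOn_integrand k p a b w lam)
    (fun _ hz => J.norm_integrand_le k p a b w lam hM hz)
    (fun _ hz h => J.integrand_eq_zero k p a b w lam hz h)).2

theorem hasDerivAt_osc : HasDerivAt (J.osc k p a b w)
    (-Complex.I * (J.osc k (p + 1) (a + 2) b w lam - J.osc k (p + 1) a (b + 2 * k) w lam)) lam := by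
  obtain ⟨M, hM⟩ := J.bdd w
  set B : ℝ := R ^ (p + 1 + (a + 2) + b) * M + R ^ (p + 1 + a + (b + 2 * k)) * M
  have hi1 := J.integrableOn_integrand k (p + 1) (a + 2) b w
  have hi2 := J.integrableOn_integrand k (p + 1) a (b + 2 * k) w
  set F' : ℝ → ℝ × ℝ × ℝ → ℂ := fun lam z => -Complex.I *
    (J.integrand k (p + 1) (a + 2) b w lam z - J.integrand k (p + 1) a (b + 2 * k) w lam z)
  have key := hasDerivAt_integral_of_dominated_loc_of_deriv_le (𝕜 := ℝ)
    (μ := volume.restrict openQuadrant) (F := fun lam z => J.integrand k p a b w lam z)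
    (F' := F') (x₀ := lam) (s := univ)
    (bound := (Metric.closedBall (0 : ℝ × ℝ × ℝ) R).indicator fun _ => B) univ_mem
    (Eventually.of_forall fun lam => (J.integrableOn_integrand k p a b w lam).1)
    (J.integrableOn_integrand k p a b w lam) (((hi1 lam).sub (hi2 lam)).const_mul _).1 ?_ ?_ ?_
  · refine key.2.congr_deriv ?_
    simp only [F', osc]
    rw [integral_const_mul, integral_sub (hi1 lam) (hi2 lam)]
  · refine ae_restrict_of_forall_mem isOpen_openQuadrant.measurableSet fun z hz lam _ => ?_
    by_cases hzR : R < ‖z‖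
    · have : z ∉ Metric.closedBall (0 : ℝ × ℝ × ℝ) R := by simpa using hzR
      simp [F', J.integrand_eq_zero k _ _ _ w lam hz hzR, indicator_of_notMem this]
    · have : z ∈ Metric.closedBall (0 : ℝ × ℝ × ℝ) R := by simpa using hzR
      rw [indicator_of_mem this]
      simp only [F', norm_mul, norm_neg, Complex.norm_I, one_mul]
      exact norm_sub_le_of_le (J.norm_integrand_le k _ _ _ w lam hM hz)
        (J.norm_integrand_le k _ _ _ w lam hM hz)
  · refine Integrable.restrict ?_
    rw [integrable_indicator_iff Metric.isClosed_closedBall.measurableSet]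
    exact integrableOn_const (isCompact_closedBall _ _).measure_lt_top.ne
  · refine Eventually.of_forall fun z lam _ => ?_
    have h1 : HasDerivAt (fun lam => wave k lam z)
        (-Complex.I * (z.1 * (z.2.1 ^ 2 - z.2.2 ^ (2 * k))) * wave k lam z) lam := by
      refine ((((hasDerivAt_id lam).mul_const
        (z.1 * (z.2.1 ^ 2 - z.2.2 ^ (2 * k)))).ofReal_comp.const_mul
        (-Complex.I)).cexp).congr_deriv ?_
      simp only [wave, id]
      push_cast
      ring
    refine ((h1.mul_const (mono p a b z)).mul_const (J.G w z)).congr_deriv ?_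
    simp only [F', integrand, mono]
    ring

theorem hasDerivAt_integrand₀ (t : ℝ) {x y : ℝ} (hx : 0 < x) (hy : 0 < y) :
    HasDerivAt (fun t => J.integrand k (p + 1) a b w lam (t, x, y))
      (-Complex.I * lam * (J.integrand k (p + 1) (a + 2) b w lam (t, x, y)
          - J.integrand k (p + 1) a (b + 2 * k) w lam (t, x, y))
        + (p + 1) * J.integrand k p a b w lam (t, x, y)
        + J.integrand k (p + 1) a b (0 :: w) lam (t, x, y)) t := by
  have h1 : HasDerivAt (fun t : ℝ => wave k lam (t, x, y)) _ t :=
    hasDerivAt_wave_comp k lam (γ := fun t => (t, x, y))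
      (hasDerivAt_mul_const (x ^ 2 - y ^ (2 * k)))
  have h2 : HasDerivAt (fun t : ℝ => mono (p + 1) a b (t, x, y))
      ((p + 1) * (t : ℂ) ^ p * (x : ℂ) ^ a * (y : ℂ) ^ b) t := by
    refine ((((hasDerivAt_id t).ofReal_comp.fun_pow (p + 1)).mul_const
      ((x : ℂ) ^ a)).mul_const ((y : ℂ) ^ b)).congr_deriv ?_
    simp
  refine ((h1.fun_mul h2).fun_mul (J.deriv₀ w t x y hx hy)).congr_deriv ?_
  simp only [integrand, mono]
  push_cast
  ring

theorem hasDerivAt_integrand₁ (t : ℝ) {x y : ℝ} (hx : 0 < x) (hy : 0 < y) :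
    HasDerivAt (fun x => J.integrand k p (a + 1) b w lam (t, x, y))
      (-2 * Complex.I * lam * J.integrand k (p + 1) (a + 2) b w lam (t, x, y)
        + (a + 1) * J.integrand k p a b w lam (t, x, y)
        + J.integrand k p (a + 1) b (1 :: w) lam (t, x, y)) x := by
  have h1 : HasDerivAt (fun x : ℝ => wave k lam (t, x, y)) _ x :=
    hasDerivAt_wave_comp k lam (γ := fun x => (t, x, y))
      (((hasDerivAt_pow 2 x).sub_const (y ^ (2 * k))).const_mul t)
  have h2 : HasDerivAt (fun x : ℝ => mono p (a + 1) b (t, x, y))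
      ((t : ℂ) ^ p * ((a + 1) * (x : ℂ) ^ a) * (y : ℂ) ^ b) x := by
    refine ((((hasDerivAt_id x).ofReal_comp.fun_pow (a + 1)).const_mul
      ((t : ℂ) ^ p)).mul_const ((y : ℂ) ^ b)).congr_deriv ?_
    simp
  refine ((h1.fun_mul h2).fun_mul (J.deriv₁ w t x y hx hy)).congr_deriv ?_
  simp only [integrand, mono]
  push_cast
  ring

theorem hasDerivAt_integrand₂ (hk : 1 ≤ k) (t : ℝ) {x y : ℝ} (hx : 0 < x) (hy : 0 < y) :
    HasDerivAt (fun y => J.integrand k p a (b + 1) w lam (t, x, y))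
      (2 * k * Complex.I * lam * J.integrand k (p + 1) a (b + 2 * k) w lam (t, x, y)
        + (b + 1) * J.integrand k p a b w lam (t, x, y)
        + J.integrand k p a (b + 1) (2 :: w) lam (t, x, y)) y := by
  obtain ⟨m, rfl⟩ := Nat.exists_eq_add_of_le' hk
  have h1 : HasDerivAt (fun y : ℝ => wave (m + 1) lam (t, x, y)) _ y :=
    hasDerivAt_wave_comp (m + 1) lam (γ := fun y => (t, x, y))
      (((hasDerivAt_pow (2 * (m + 1)) y).const_sub (x ^ 2)).const_mul t)
  have h2 : HasDerivAt (fun y : ℝ => mono p a (b + 1) (t, x, y))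
      ((t : ℂ) ^ p * (x : ℂ) ^ a * ((b + 1) * (y : ℂ) ^ b)) y := by
    refine (((hasDerivAt_id y).ofReal_comp.fun_pow (b + 1)).const_mul
      ((t : ℂ) ^ p * (x : ℂ) ^ a)).congr_deriv ?_
    simp
  refine ((h1.fun_mul h2).fun_mul (J.deriv₂ w t x y hx hy)).congr_deriv ?_
  simp only [integrand, mono, show 2 * (m + 1) - 1 = 2 * m + 1 by omega]
  push_cast
  ring

/-- The integral of the `χ₀`-derivative of the integrand with exponent `p + 1` vanishes by compact
support. -/
theorem osc_parts₀ :
    -Complex.I * lam * (J.osc k (p + 1) (a + 2) b w lam - J.osc k (p + 1) a (b + 2 * k) w lam)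
      + (p + 1) * J.osc k p a b w lam + J.osc k (p + 1) a b (0 :: w) lam = 0 := by
  have e := integral_openQuadrant_eq_zero_of_fst
    (h := fun z => -Complex.I * lam * (J.integrand k (p + 1) (a + 2) b w lam z
        - J.integrand k (p + 1) a (b + 2 * k) w lam z)
      + (p + 1) * J.integrand k p a b w lam z + J.integrand k (p + 1) a b (0 :: w) lam z)
    fun x y hx hy =>
    integral_deriv_eq_zero (R := R)
      (fun t => J.hasDerivAt_integrand₀ k p a b w lam t hx hy) fun t ht =>
        J.integrand_eq_zero k _ _ _ w lam (mem_openQuadrant.2 ⟨hx, hy⟩)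
          (ht.trans_le (norm_fst_le (t, x, y)))
  have i := J.integrableOn_integrand k
  rw [integral_mul_add_mul_add (f := fun z => J.integrand k (p + 1) (a + 2) b w lam z
      - J.integrand k (p + 1) a (b + 2 * k) w lam z) ((i _ _ _ _ _).sub (i _ _ _ _ _))
      (i _ _ _ _ _) (i _ _ _ _ _), integral_sub (i _ _ _ _ _) (i _ _ _ _ _)] at e
  exact e

theorem exists_bound_integrand {t : ℝ} : ∃ C, ∀ x y, 0 < x → 0 < y →
    ‖J.integrand k p a b w lam (t, x, y)‖ ≤ C * x ^ a * y ^ b := by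
  obtain ⟨M, hM⟩ := J.bdd w
  refine ⟨|t| ^ p * M, fun x y hx hy => ?_⟩
  have h := hM (t, x, y) (mem_openQuadrant.2 ⟨hx, hy⟩)
  simp only [integrand, norm_mul, norm_wave, mono, norm_pow, Complex.norm_real, one_mul,
    Real.norm_eq_abs, abs_of_pos hx, abs_of_pos hy]
  calc |t| ^ p * x ^ a * y ^ b * ‖J.G w (t, x, y)‖ ≤ |t| ^ p * x ^ a * y ^ b * M := by gcongr
    _ = _ := by ring

/-- The integral of the `χ₁`-derivative of the integrand with exponent `a + 1` vanishes: the extra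
factor `χ₁` removes the boundary term at `χ₁ = 0`. -/
theorem osc_parts₁ :
    -2 * Complex.I * lam * J.osc k (p + 1) (a + 2) b w lam
      + (a + 1) * J.osc k p a b w lam + J.osc k p (a + 1) b (1 :: w) lam = 0 := by
  have e := integral_openQuadrant_eq_zero
    (h := fun z => -2 * Complex.I * lam * J.integrand k (p + 1) (a + 2) b w lam z
      + (a + 1) * J.integrand k p a b w lam z + J.integrand k p (a + 1) b (1 :: w) lam z)
    fun t => integral_Ioi_prod_eq_zero_left fun y hy =>
    integral_Ioi_deriv_eq_zero (R := R) (a := a)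
      (C := (J.exists_bound_integrand k p (a + 1) b w lam (t := t)).choose * y ^ b)
      (fun x hx => J.hasDerivAt_integrand₁ k p a b w lam t hx hy) (by simp [integrand, mono])
      (fun x hx => ((J.exists_bound_integrand k p (a + 1) b w lam
        (t := t)).choose_spec x y hx hy).trans_eq (by ring)) fun x hx hR =>
        J.integrand_eq_zero k _ _ _ w lam (mem_openQuadrant.2 ⟨hx, hy⟩)
          (hR.trans_le ((norm_fst_le (x, y)).trans (norm_snd_le (t, x, y))))
  have i := J.integrableOn_integrand k
  rw [integral_mul_add_mul_add (i _ _ _ _ _) (i _ _ _ _ _) (i _ _ _ _ _)] at e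
  exact e

theorem osc_parts₂ (hk : 1 ≤ k) :
    2 * k * Complex.I * lam * J.osc k (p + 1) a (b + 2 * k) w lam
      + (b + 1) * J.osc k p a b w lam + J.osc k p a (b + 1) (2 :: w) lam = 0 := by
  have e := integral_openQuadrant_eq_zero
    (h := fun z => 2 * k * Complex.I * lam * J.integrand k (p + 1) a (b + 2 * k) w lam z
      + (b + 1) * J.integrand k p a b w lam z + J.integrand k p a (b + 1) (2 :: w) lam z)
    fun t => integral_Ioi_prod_eq_zero_right fun x hx =>
    integral_Ioi_deriv_eq_zero (R := R) (a := b)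
      (C := (J.exists_bound_integrand k p a (b + 1) w lam (t := t)).choose * x ^ a)
      (fun y hy => J.hasDerivAt_integrand₂ k p a b w lam hk t hx hy) (by simp [integrand, mono])
      (fun y hy => (J.exists_bound_integrand k p a (b + 1) w lam
        (t := t)).choose_spec x y hx hy) fun y hy hR =>
        J.integrand_eq_zero k _ _ _ w lam (mem_openQuadrant.2 ⟨hx, hy⟩)
          (hR.trans_le ((norm_snd_le (x, y)).trans (norm_snd_le (t, x, y))))
  have i := J.integrableOn_integrand k
  rw [integral_mul_add_mul_add (i _ _ _ _ _) (i _ _ _ _ _) (i _ _ _ _ _)] at e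
  exact e

end Jet

end OscillatoryIntegrals

/-! ### Decay at high order and the chain of Euler equations -/

section EulerChain

namespace Jet

variable {R : ℝ} (J : Jet R) (k : ℕ) (p a b : ℕ) (w : List (Fin 3)) (lam : ℝ)

/-- The derivative of `Jet.osc` in the large parameter. -/
noncomputable def oscDeriv : ℂ :=
  -Complex.I * (J.osc k (p + 1) (a + 2) b w lam - J.osc k (p + 1) a (b + 2 * k) w lam)

theorem euler_fst : lam * J.oscDeriv k p a b w lam + (p + 1) * J.osc k p a b w lam
    = -J.osc k (p + 1) a b (0 :: w) lam := by
  rw [oscDeriv]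
  linear_combination J.osc_parts₀ k p a b w lam

/-- Half of `osc_parts₁` plus `1/(2k)` times `osc_parts₂`: with these weights the two terms
containing `lam` add up to `lam` times the derivative in `lam`. -/
theorem euler_weighted (hk : 1 ≤ k) : lam * J.oscDeriv k p a b w lam
      + ((k : ℂ) + 1 + (k * a + b)) / (2 * k) * J.osc k p a b w lam
    = -(1 / 2) * J.osc k p (a + 1) b (1 :: w) lam
      + -(1 / (2 * k)) * J.osc k p a (b + 1) (2 :: w) lam := by
  have hk0 : (k : ℂ) ≠ 0 := by
    have : k ≠ 0 := by omega
    exact_mod_cast this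
  have h1 := J.osc_parts₁ k p a b w lam
  have h2 := J.osc_parts₂ k p a b w lam hk
  rw [oscDeriv]
  field_simp
  linear_combination k * h1 + h2

end Jet

/-- Jets together with a bound for the components given by words of length at most `n`. -/
def BoundedJet (R : ℝ) (n : ℕ) : Type :=
  {x : Jet R × ℝ // ∀ w : List (Fin 3), w.length ≤ n → ∀ z ∈ openQuadrant, ‖x.1.G w z‖ ≤ x.2}

namespace BoundedJet

variable {R : ℝ} {n : ℕ}

/-- The bound carried by a bounded jet. -/
def bound (i : BoundedJet R n) : ℝ := i.1.2

theorem bound_nonneg (i : BoundedJet R n) : 0 ≤ i.bound := by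
  obtain ⟨z, hz⟩ := openQuadrant_nonempty
  exact (norm_nonneg _).trans (i.2 [] (Nat.zero_le _) z hz)

variable {k : ℕ}

theorem norm_le_of_mul_norm_le {κ t B : ℝ} {N : ℕ} {X : ℂ} (hκ : 1 ≤ κ) (ht : 1 ≤ t)
    (h : κ * t * ‖X‖ ≤ B * t ^ (-(N : ℝ))) : ‖X‖ ≤ B * t ^ (-((N + 1 : ℕ) : ℝ)) := by
  have ht0 : 0 < t := by linarith
  have e : t ^ (-((N + 1 : ℕ) : ℝ)) = t ^ (-(N : ℝ)) / t := by
    rw [← Real.rpow_sub_one ht0.ne']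
    push_cast
    ring_nf
  rw [e, ← mul_div_assoc, le_div_iff₀ ht0]
  refine le_trans ?_ h
  have : 0 ≤ t * ‖X‖ := by positivity
  nlinarith

/-- Each factor `χ₀ χ₁²` or `χ₀ χ₂^{2k}` is traded for a factor `1/t` by `osc_parts₁` or
`osc_parts₂`, at the cost of at most one derivative. With `N` such factors available this can be
done `N` times. -/
theorem exists_decay (hk : 1 ≤ k) (N : ℕ) : ∀ (p a b : ℕ) (w : List (Fin 3)), N ≤ p →
    (2 * N ≤ a ∨ 2 * k * N ≤ b) → w.length + N ≤ n →
    ∃ C, 0 ≤ C ∧ ∀ (i : BoundedJet R n) (t : ℝ), 1 ≤ t →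
      ‖i.1.1.osc k p a b w t‖ ≤ C * i.bound * t ^ (-(N : ℝ)) := by
  induction N with
  | zero =>
    intro p a b w _ _ hw
    refine ⟨|R| ^ (p + a + b) * volume.real (Metric.closedBall (0 : ℝ × ℝ × ℝ) R), by positivity,
      fun i t _ => ?_⟩
    refine (i.1.1.norm_osc_le k p a b w t (i.2 w (by omega))).trans_eq ?_
    rw [abs_of_nonneg i.1.1.nonneg, bound]
    simp
    ring
  | succ N ih =>
    rintro p a b w hp hab hw
    obtain ⟨p, rfl⟩ := Nat.exists_eq_add_of_le' (show 1 ≤ p by omega)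
    rcases hab with ha | hb
    · obtain ⟨a, rfl⟩ := Nat.exists_eq_add_of_le' (show 2 ≤ a by omega)
      obtain ⟨C₁, hC₁, h₁⟩ := ih p a b w (by omega) (Or.inl (by omega)) (by omega)
      obtain ⟨C₂, hC₂, h₂⟩ := ih p (a + 1) b (1 :: w) (by omega) (Or.inl (by omega))
        (by simp only [List.length_cons]; omega)
      refine ⟨(a + 1) * C₁ + C₂, by positivity, fun i t ht => ?_⟩
      refine norm_le_of_mul_norm_le one_le_two ht ?_
      have e : 2 * Complex.I * t * i.1.1.osc k (p + 1) (a + 2) b w t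
          = (a + 1 : ℝ) * i.1.1.osc k p a b w t + i.1.1.osc k p (a + 1) b (1 :: w) t := by
        push_cast
        linear_combination -i.1.1.osc_parts₁ k p a b w t
      have e' := congrArg norm e
      simp only [norm_mul, Complex.norm_I, Complex.norm_real, Complex.norm_ofNat, mul_one,
        Real.norm_of_nonneg (zero_le_one.trans ht)] at e'
      rw [e']
      refine (norm_add_le _ _).trans ?_
      rw [norm_mul, Complex.norm_real, Real.norm_of_nonneg (by positivity)]
      calc (a + 1 : ℝ) * ‖i.1.1.osc k p a b w t‖ + ‖i.1.1.osc k p (a + 1) b (1 :: w) t‖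
          ≤ (a + 1) * (C₁ * i.bound * t ^ (-(N : ℝ))) + C₂ * i.bound * t ^ (-(N : ℝ)) := by
            gcongr
            · exact h₁ i t ht
            · exact h₂ i t ht
        _ = _ := by ring
    · have hb' : 2 * k * N + 2 * k ≤ b := by rwa [← Nat.mul_succ]
      obtain ⟨b, rfl⟩ := Nat.exists_eq_add_of_le' (show 2 * k ≤ b by omega)
      obtain ⟨C₁, hC₁, h₁⟩ := ih p a b w (by omega) (Or.inr (by omega)) (by omega)
      obtain ⟨C₂, hC₂, h₂⟩ := ih p a (b + 1) (2 :: w) (by omega) (Or.inr (by omega))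
        (by simp only [List.length_cons]; omega)
      refine ⟨(b + 1) * C₁ + C₂, by positivity, fun i t ht => ?_⟩
      have hk1 : (1 : ℝ) ≤ k := by exact_mod_cast hk
      refine norm_le_of_mul_norm_le (κ := 2 * k) (by linarith) ht ?_
      have e : 2 * k * Complex.I * t * i.1.1.osc k (p + 1) a (b + 2 * k) w t
          = -((b + 1 : ℝ) * i.1.1.osc k p a b w t + i.1.1.osc k p a (b + 1) (2 :: w) t) := by
        push_cast
        linear_combination i.1.1.osc_parts₂ k p a b w t hk
      have e' := congrArg norm e
      simp only [norm_mul, Complex.norm_I, Complex.norm_real, Complex.norm_ofNat, mul_one,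
        Real.norm_of_nonneg (zero_le_one.trans ht), norm_neg, Complex.norm_natCast] at e'
      rw [e']
      refine (norm_add_le _ _).trans ?_
      rw [norm_mul, Complex.norm_real, Real.norm_of_nonneg (by positivity)]
      calc (b + 1 : ℝ) * ‖i.1.1.osc k p a b w t‖ + ‖i.1.1.osc k p a (b + 1) (2 :: w) t‖
          ≤ (b + 1) * (C₁ * i.bound * t ^ (-(N : ℝ))) + C₂ * i.bound * t ^ (-(N : ℝ)) := by
            gcongr
            · exact h₁ i t ht
            · exact h₂ i t ht
        _ = _ := by ring

/-- The oscillatory integral of the component `w` of the jet, multiplied by the monomial whose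
exponents count the letters of `w`. -/
noncomputable def wordOsc (k : ℕ) (w : List (Fin 3)) (i : BoundedJet R n) (t : ℝ) : ℂ :=
  i.1.1.osc k (w.count 0) (w.count 1) (w.count 2) w t

theorem exists_wordOsc_one_le {w : List (Fin 3)} (hw : w.length ≤ n) :
    ∃ C, 0 ≤ C ∧ ∀ i : BoundedJet R n, ‖wordOsc k w i 1‖ ≤ C * i.bound := by
  refine ⟨|R| ^ (w.count 0 + w.count 1 + w.count 2)
    * volume.real (Metric.closedBall (0 : ℝ × ℝ × ℝ) R), by positivity, fun i => ?_⟩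
  refine (i.1.1.norm_osc_le k _ _ _ w 1 (i.2 w hw)).trans_eq ?_
  rw [abs_of_nonneg i.1.1.nonneg, bound]
  ring

theorem unifExp_wordOsc_of_euler {w : List (Fin 3)} (hw : w.length ≤ n) {S L : Finset ℝ} {r N : ℝ}
    (hr : r ∉ L) (hN : r ≠ N)
    (h : UnifExp (bound (R := R) (n := n)) S L N fun i t =>
      t * i.1.1.oscDeriv k (w.count 0) (w.count 1) (w.count 2) w t + r * wordOsc k w i t) :
    UnifExp (bound (R := R) (n := n)) (S ∪ L ∪ {r}) (L ∪ (S ∩ {r})) N (wordOsc k w) :=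
  .of_euler bound_nonneg hr hN (fun i t _ => i.1.1.hasDerivAt_osc k _ _ _ w t)
    (exists_wordOsc_one_le hw) h

/-- The power of `χ₁` or `χ₂` already suffices for decay, and `euler_fst` supplies the missing
powers of `χ₀` one at a time. -/
theorem unifExp_wordOsc_of_weight_ge (hk : 1 ≤ k) {N₀ : ℕ} {N : ℝ} (hN : N ≤ N₀)
    (hne : ∀ q : ℕ, (q : ℝ) ≠ N) (j : ℕ) : ∀ w : List (Fin 3), w.count 0 + j = N₀ →
      (2 * N₀ ≤ w.count 1 ∨ 2 * k * N₀ ≤ w.count 2) → w.length + j + N₀ ≤ n →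
      UnifExp (bound (R := R) (n := n))
        ((Finset.Ioc (w.count 0) N₀).image (fun q : ℕ => (q : ℝ))) ∅ N (wordOsc k w) := by
  induction j with
  | zero =>
    intro w hw hab hn
    obtain ⟨C, hC, h⟩ := exists_decay (R := R) (n := n) hk N₀ (w.count 0) (w.count 1) (w.count 2) w
      (by omega) hab (by omega)
    refine .of_norm_le bound_nonneg hC fun i t ht => (h i t ht).trans ?_
    have := bound_nonneg i
    gcongr
  | succ j ih =>
    intro w hw hab hn
    have h0 : (0 :: w).count 0 = w.count 0 + 1 := by simp
    have h1 : (0 :: w).count 1 = w.count 1 := by simp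
    have h2 : (0 :: w).count 2 = w.count 2 := by simp
    have h := ih (0 :: w) (by omega) (by rwa [h1, h2]) (by simp only [List.length_cons]; omega)
    rw [h0] at h
    have hs := unifExp_wordOsc_of_euler (R := R) (n := n) (k := k) (w := w) (by omega)
      (r := ((w.count 0 + 1 : ℕ) : ℝ)) (N := N) (L := ∅)
      (S := (Finset.Ioc (w.count 0 + 1) N₀).image (fun q : ℕ => (q : ℝ)))
      (Finset.notMem_empty _) (hne _) ?_
    · refine hs.mono bound_nonneg ?_ ?_
      · intro s hs
        simp only [Finset.union_empty, Finset.mem_union, Finset.mem_image, Finset.mem_Ioc,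
          Finset.mem_singleton] at hs ⊢
        rcases hs with ⟨q, hq, rfl⟩ | rfl
        · exact ⟨q, ⟨by omega, hq.2⟩, rfl⟩
        · exact ⟨_, ⟨by omega, by omega⟩, rfl⟩
      -- No resonance: the new exponent is smaller than all the earlier ones.
      · intro s hs
        simp only [Finset.empty_union, Finset.mem_inter, Finset.mem_image, Finset.mem_Ioc,
          Finset.mem_singleton] at hs
        obtain ⟨⟨q, hq, rfl⟩, h⟩ := hs
        have : q = w.count 0 + 1 := by exact_mod_cast h
        omega
    · have h' := h.const_mul (-1)
      convert h' using 3 with i t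
      have e := i.1.1.euler_fst k (w.count 0) (w.count 1) (w.count 2) w t
      simp only [wordOsc, h0, h1, h2]
      push_cast
      rw [e]
      ring

/-- Descending induction on the lower bound `m` for the weight `k a + b`. Only at weight exactly `m`
is an Euler equation solved, so each weighted exponent enters once. It can coincide only with
integers coming from the `χ₀` chain, and there a logarithm appears. -/
theorem unifExp_wordOsc (hk : 1 ≤ k) {N₀ : ℕ} {N : ℝ} (hN : N ≤ N₀)
    (hne : ∀ q : ℕ, (q : ℝ) / (2 * k) ≠ N) (hn : 4 * k * N₀ + 2 * N₀ ≤ n) (j m : ℕ)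
    (hm : m + j = 4 * k * N₀) : ∀ w : List (Fin 3), w.count 0 = 0 →
      m ≤ k * w.count 1 + w.count 2 → w.length ≤ m →
      UnifExp (bound (R := R) (n := n))
        ((Finset.Ioc 0 N₀).image (fun q : ℕ => (q : ℝ)) ∪
          (Finset.Ico m (4 * k * N₀)).image (fun q : ℕ => ((k + 1 + q : ℕ) : ℝ) / (2 * k)))
        ((Finset.Ico m (4 * k * N₀)).image (fun q : ℕ => ((k + 1 + q : ℕ) : ℝ) / (2 * k)) ∩
          (Finset.Ioc 0 N₀).image (fun q : ℕ => (q : ℝ))) N (wordOsc k w) := by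
  have hk0 : (k : ℝ) ≠ 0 := by
    have : k ≠ 0 := by omega
    exact_mod_cast this
  induction j generalizing m with
  | zero =>
    intro w h0 hW hl
    refine UnifExp.mono bound_nonneg (unifExp_wordOsc_of_weight_ge hk hN (fun q => ?_) N₀ w
      (by omega) ?_ (by omega)) ?_ (by simp)
    · have := hne (2 * k * q)
      push_cast at this
      rwa [mul_div_cancel_left₀ _ (by simpa using hk0)] at this
    -- Weight at least `4kN₀` forces `a ≥ 2N₀` or `b ≥ 2kN₀`.
    · by_contra! hcon
      have h1 : k * w.count 1 ≤ k * (2 * N₀) := Nat.mul_le_mul_left _ hcon.1.le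
      have h2 : k * (2 * N₀) + 2 * k * N₀ = 4 * k * N₀ := by ring
      omega
    · rw [h0]
      exact Finset.subset_union_left
  | succ j ih =>
    intro w h0 hW hl
    have ih := ih (m + 1) (by omega)
    have hIco : Finset.Ico (m + 1) (4 * k * N₀) ⊆ Finset.Ico m (4 * k * N₀) :=
      Finset.Ico_subset_Ico_left (Nat.le_succ m)
    rcases hW.lt_or_eq with hlt | heq
    · refine (ih w h0 hlt (by omega)).mono bound_nonneg ?_ ?_
      · exact Finset.union_subset_union_right (Finset.image_subset_image hIco)
      · exact Finset.inter_subset_inter_right (Finset.image_subset_image hIco)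
    -- A letter `1` raises the weight by `k ≥ 1` and a letter `2` by one, so both words fall under
    -- the induction hypothesis.
    · have e1 := ih (1 :: w) (by simpa using h0) (by simp; nlinarith)
        (by simp only [List.length_cons]; omega)
      have e2 := ih (2 :: w) (by simpa using h0) (by simp; omega)
        (by simp only [List.length_cons]; omega)
      have e3 := ((e1.const_mul (-(1 / 2))).add (e2.const_mul (-(1 / (2 * k))))).congr
        (g := fun i t => t * i.1.1.oscDeriv k (w.count 0) (w.count 1) (w.count 2) w t
          + (((k + 1 + m : ℕ) : ℝ) / (2 * k) : ℝ) * wordOsc k w i t) ?_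
      · refine (unifExp_wordOsc_of_euler (by omega) ?_ (hne _) e3).mono bound_nonneg ?_ ?_
        -- The exponents with logarithms so far have index at least `m + 1`, so `r` is not among
        -- them.
        · intro h
          simp only [Finset.mem_inter, Finset.mem_image, Finset.mem_Ico] at h
          obtain ⟨⟨q, hq, h⟩, -⟩ := h
          rw [div_left_inj' (by simpa using hk0)] at h
          have : k + 1 + q = k + 1 + m := by exact_mod_cast h
          omega
        · intro s hs
          simp only [Finset.mem_union, Finset.mem_inter, Finset.mem_image, Finset.mem_Ico,
            Finset.mem_singleton] at hs ⊢
          rcases hs with ((h | ⟨q, hq, rfl⟩) | ⟨-, h⟩) | rfl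
          · exact Or.inl h
          · exact Or.inr ⟨q, ⟨by omega, hq.2⟩, rfl⟩
          · exact Or.inl h
          · exact Or.inr ⟨m, ⟨le_rfl, by omega⟩, rfl⟩
        · intro s hs
          simp only [Finset.mem_union, Finset.mem_inter, Finset.mem_image, Finset.mem_Ico,
            Finset.mem_singleton] at hs ⊢
          rcases hs with ⟨⟨q, hq, rfl⟩, h⟩ | ⟨h | ⟨q, hq, h⟩, rfl⟩
          · exact ⟨⟨q, ⟨by omega, hq.2⟩, rfl⟩, h⟩
          · exact ⟨⟨m, ⟨le_rfl, by omega⟩, rfl⟩, h⟩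
          · rw [div_left_inj' (by simpa using hk0)] at h
            have : k + 1 + q = k + 1 + m := by exact_mod_cast h
            omega
      · intro i t
        have e := i.1.1.euler_weighted k (w.count 0) (w.count 1) (w.count 2) w t hk
        have h10 : (1 :: w).count 0 = w.count 0 := by simp
        have h11 : (1 :: w).count 1 = w.count 1 + 1 := by simp
        have h12 : (1 :: w).count 2 = w.count 2 := by simp
        have h20 : (2 :: w).count 0 = w.count 0 := by simp
        have h21 : (2 :: w).count 1 = w.count 1 := by simp
        have h22 : (2 :: w).count 2 = w.count 2 + 1 := by simp
        simp only [wordOsc, h10, h11, h12, h20, h21, h22]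
        rw [← e, heq]
        push_cast
        ring

/-- The uniform asymptotic expansion of the oscillatory integrals to any finite order. -/
theorem exists_unifExp (hk : 1 ≤ k) (R : ℝ) (N₀ : ℕ) : ∃ n Q : ℕ, ∀ Q', Q ≤ Q' →
    UnifExp (bound (R := R) (n := n))
      ((Finset.range Q').image (fun l : ℕ => ((l : ℝ) + 1) / (2 * k)))
      ((Finset.range Q').image (fun j : ℕ => (j : ℝ) + 1)) (N₀ - 1 / (4 * k)) (wordOsc k []) := by
  have hk0 : (0 : ℝ) < k := by exact_mod_cast hk
  -- Derivatives are spent on at most `4kN₀` weighted steps, `N₀` steps in `χ₀` and `N₀` steps of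
  -- decay.
  refine ⟨4 * k * N₀ + 2 * N₀, k + 1 + 4 * k * N₀, fun Q' hQ => ?_⟩
  have hkN : N₀ ≤ k * N₀ := Nat.le_mul_of_pos_left _ hk
  have e4 : 4 * k * N₀ = 4 * (k * N₀) := by ring
  refine UnifExp.mono bound_nonneg (unifExp_wordOsc hk (N₀ := N₀) ?_ ?_ le_rfl (4 * k * N₀) 0
    (by omega) [] (by simp) (by simp) (by simp)) ?_ ?_
  · have : 0 < 1 / (4 * (k : ℝ)) := by positivity
    linarith
  -- The error exponent `N₀ - 1/(4k)` lies off the grid `q/(2k)`: equality would give `4q + 2 =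
  -- 8kN₀`, impossible modulo 4.
  · intro q h
    field_simp at h
    have h' : ((4 * q + 2 : ℕ) : ℝ) = ((2 * 4 * k * N₀ : ℕ) : ℝ) := by
      push_cast
      linarith
    have h2 : 4 * q + 2 = 2 * 4 * k * N₀ := by exact_mod_cast h'
    have h3 : 2 * 4 * k * N₀ = 8 * (k * N₀) := by ring
    omega
  · intro s hs
    simp only [Finset.mem_union, Finset.mem_image, Finset.mem_Ico, Finset.mem_Ioc,
      Finset.mem_range] at hs ⊢
    rcases hs with ⟨q, hq, rfl⟩ | ⟨q, hq, rfl⟩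
    · have hkq : 1 ≤ k * q := Nat.mul_pos hk hq.1
      have hkq' : k * q ≤ k * N₀ := Nat.mul_le_mul_left _ hq.2
      refine ⟨2 * (k * q) - 1, by omega, ?_⟩
      rw [Nat.cast_sub (by omega)]
      push_cast
      field_simp
      ring
    · refine ⟨k + q, by omega, ?_⟩
      push_cast
      ring
  · intro s hs
    simp only [Finset.mem_inter, Finset.mem_image, Finset.mem_Ioc, Finset.mem_range] at hs ⊢
    obtain ⟨-, q, hq, rfl⟩ := hs
    refine ⟨q - 1, by omega, ?_⟩
    rw [Nat.cast_sub hq.1]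
    simp

end BoundedJet

end EulerChain

/-! ### Uniqueness of the coefficients and passage to the infinite expansion -/

section Coefficients

theorem isLittleO_rpow_neg_mul_log {r s : ℝ} (h : r < s) :
    (fun t : ℝ => t ^ (-s) * Real.log t) =o[atTop] fun t : ℝ => t ^ (-r) := by
  refine ((isBigO_refl (fun t : ℝ => t ^ (-s)) atTop).mul_isLittleO
    (isLittleO_log_rpow_atTop (sub_pos.2 h))).congr' (EventuallyEq.refl _ _) ?_
  filter_upwards [eventually_gt_atTop 0] with t ht
  rw [← Real.rpow_add ht]
  ring_nf

theorem isLittleO_rpow_neg {r s : ℝ} (h : r < s) :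
    (fun t : ℝ => t ^ (-s)) =o[atTop] fun t : ℝ => t ^ (-r) := by
  have h1 : (fun _ : ℝ => (1 : ℝ)) =o[atTop] Real.log := Real.isLittleO_const_log_atTop
  simpa using ((isBigO_refl (fun t : ℝ => t ^ (-s)) atTop).mul_isLittleO h1).trans
    (isLittleO_rpow_neg_mul_log h)

/-- After multiplication by `t^r` one has `a + b log t → 0`; division by `log t` gives `b = 0`, then
`a = 0`. -/
theorem eq_zero_of_isLittleO_rpow {a b : ℂ} {r : ℝ}
    (h : (fun t : ℝ => a * ((t ^ (-r) : ℝ) : ℂ) + b * ((t ^ (-r) * Real.log t : ℝ) : ℂ))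
      =o[atTop] fun t : ℝ => t ^ (-r)) : a = 0 ∧ b = 0 := by
  have h1 : (fun t : ℝ => a + b * (Real.log t : ℂ)) =o[atTop] fun _ : ℝ => (1 : ℝ) := by
    have h2 := ((isBigO_refl (fun t : ℝ => ((t ^ r : ℝ) : ℂ)) atTop).mul_isLittleO
      (Complex.isLittleO_ofReal_right.2 h))
    have e : ∀ t : ℝ, 0 < t → ((t ^ r : ℝ) : ℂ) * ((t ^ (-r) : ℝ) : ℂ) = 1 := by
      intro t ht
      rw [← Complex.ofReal_mul, ← Real.rpow_add ht]
      simp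
    refine Complex.isLittleO_ofReal_right.1 (h2.congr' ?_ ?_)
    · filter_upwards [eventually_gt_atTop 0] with t ht
      rw [Complex.ofReal_mul]
      linear_combination (a + b * (Real.log t : ℂ)) * e t ht
    · filter_upwards [eventually_gt_atTop 0] with t ht
      rw [e t ht, Complex.ofReal_one]
  have h2 : Tendsto (fun t : ℝ => a + b * (Real.log t : ℂ)) atTop (𝓝 0) :=
    (isLittleO_one_iff ℝ).1 h1
  have h3 : Tendsto (fun t : ℝ => (((Real.log t)⁻¹ : ℝ) : ℂ)) atTop (𝓝 0) := by
    exact_mod_cast (Complex.continuous_ofReal.tendsto 0).comp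
      (tendsto_inv_atTop_zero.comp Real.tendsto_log_atTop)
  have h4 : Tendsto (fun t : ℝ => (((Real.log t)⁻¹ : ℝ) : ℂ) * (a + b * (Real.log t : ℂ)))
      atTop (𝓝 b) := by
    have h5 := (h3.mul_const a).add_const b
    rw [zero_mul, zero_add] at h5
    refine h5.congr' ?_
    filter_upwards [eventually_gt_atTop 1] with t ht
    have : (Real.log t : ℂ) ≠ 0 := by
      exact_mod_cast (Real.log_pos ht).ne'
    push_cast
    field_simp
  have hb : b = 0 := by
    refine tendsto_nhds_unique h4 ?_
    simpa using h3.mul h2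
  subst hb
  simp only [zero_mul, add_zero] at h2
  exact ⟨tendsto_nhds_unique tendsto_const_nhds h2, rfl⟩

/-- The expansion of `HasLogExpansion` at one order. -/
def ExpandsAt (k : ℕ) (J : ℝ → ℂ) (c d : ℕ → ℂ) (n : ℕ) : Prop :=
  (fun lam : ℝ => J lam
      - ∑ l ∈ Finset.range n, c l * ((lam ^ (-(((l : ℝ) + 1) / (2 * (k : ℝ)))) : ℝ) : ℂ)
      - ∑ j ∈ Finset.range (n / (2 * k)),
          d j * ((lam ^ (-((j : ℝ) + 1)) * Real.log lam : ℝ) : ℂ))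
    =o[atTop] fun lam : ℝ => lam ^ (-((n : ℝ) / (2 * (k : ℝ))))

variable {k : ℕ} {J J' : ℝ → ℂ} {c d c' d' : ℕ → ℂ} {n : ℕ}

theorem ExpandsAt.add (h : ExpandsAt k J c d n) (h' : ExpandsAt k J' c' d' n) :
    ExpandsAt k (fun t => J t + J' t) (fun l => c l + c' l) (fun j => d j + d' j) n := by
  refine (IsLittleO.add h h').congr_left fun t => ?_
  simp only [add_mul, Finset.sum_add_distrib]
  ring

theorem ExpandsAt.const_mul (a : ℂ) (h : ExpandsAt k J c d n) :
    ExpandsAt k (fun t => a * J t) (fun l => a * c l) (fun j => a * d j) n := by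
  refine (IsLittleO.const_mul_left h a).congr_left fun t => ?_
  simp only [mul_sub, Finset.mul_sum, mul_assoc]

theorem ExpandsAt.coeff_eq_zero (hk : 1 ≤ k) (h : ∀ m ≤ n, ExpandsAt k (fun _ => 0) c d m) :
    (∀ l < n, c l = 0) ∧ ∀ j < n / (2 * k), d j = 0 := by
  induction n with
  | zero => simp
  | succ n ih =>
    obtain ⟨ihc, ihd⟩ := ih fun m hm => h m (by omega)
    have hn := h (n + 1) le_rfl
    have hk0 : (k : ℝ) ≠ 0 := by
      have : k ≠ 0 := by omega
      exact_mod_cast this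
    have hc : ∀ t : ℝ, ∑ l ∈ Finset.range (n + 1),
        c l * ((t ^ (-(((l : ℝ) + 1) / (2 * (k : ℝ)))) : ℝ) : ℂ)
        = c n * ((t ^ (-(((n : ℝ) + 1) / (2 * (k : ℝ)))) : ℝ) : ℂ) := by
      intro t
      rw [Finset.sum_range_succ, Finset.sum_eq_zero, zero_add]
      intro l hl
      rw [ihc l (Finset.mem_range.1 hl), zero_mul]
    have hd0 : ∀ t : ℝ, ∑ j ∈ Finset.range (n / (2 * k)),
        d j * ((t ^ (-((j : ℝ) + 1)) * Real.log t : ℝ) : ℂ) = 0 := by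
      intro t
      refine Finset.sum_eq_zero fun j hj => ?_
      rw [ihd j (Finset.mem_range.1 hj), zero_mul]
    unfold ExpandsAt at hn
    simp only [hc] at hn
    rw [Nat.succ_div] at hn ⊢
    simp only [Nat.cast_add, Nat.cast_one] at hn
    -- Order `n + 1` brings one new power, accompanied by a logarithmic term of the same exponent
    -- exactly when `2k ∣ n + 1`.
    by_cases hdvd : 2 * k ∣ n + 1
    · have hq : n + 1 = 2 * k * (n / (2 * k) + 1) := by
        have h1 := Nat.mul_div_cancel' hdvd
        rw [Nat.succ_div, if_pos hdvd] at h1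
        exact h1.symm
      have hqr : ((n / (2 * k) : ℕ) : ℝ) + 1 = ((n : ℝ) + 1) / (2 * k) := by
        rw [eq_div_iff (by simpa using hk0)]
        have : ((n + 1 : ℕ) : ℝ) = ((2 * k * (n / (2 * k) + 1) : ℕ) : ℝ) := by rw [← hq]
        push_cast at this ⊢
        linarith
      simp only [if_pos hdvd, Finset.sum_range_succ, hd0, hqr] at hn
      have := eq_zero_of_isLittleO_rpow (a := c n) (b := d (n / (2 * k)))
        (hn.neg_left.congr_left fun t => by push_cast; ring)
      rw [if_pos hdvd]
      refine ⟨fun l hl => ?_, fun j hj => ?_⟩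
      · rcases Nat.lt_succ_iff_lt_or_eq.1 hl with h | rfl
        exacts [ihc l h, this.1]
      · rcases Nat.lt_succ_iff_lt_or_eq.1 hj with h | rfl
        exacts [ihd j h, this.2]
    · simp only [if_neg hdvd, add_zero, hd0] at hn
      have := eq_zero_of_isLittleO_rpow (a := c n) (b := 0)
        (hn.neg_left.congr_left fun t => by push_cast; ring)
      rw [if_neg hdvd, add_zero]
      refine ⟨fun l hl => ?_, ihd⟩
      rcases Nat.lt_succ_iff_lt_or_eq.1 hl with h | rfl
      exacts [ihc l h, this.1]

theorem ExpandsAt.coeff_unique (hk : 1 ≤ k) (h : ∀ m ≤ n, ExpandsAt k J c d m)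
    (h' : ∀ m ≤ n, ExpandsAt k J c' d' m) :
    (∀ l < n, c l = c' l) ∧ ∀ j < n / (2 * k), d j = d' j := by
  have h0 : ∀ m ≤ n, ExpandsAt k (fun _ => 0) (fun l => c l + -1 * c' l)
      (fun j => d j + -1 * d' j) m := by
    intro m hm
    have := (h m hm).add ((h' m hm).const_mul (-1))
    simpa using this
  obtain ⟨h1, h2⟩ := ExpandsAt.coeff_eq_zero hk h0
  exact ⟨fun l hl => by linear_combination h1 l hl, fun j hj => by linear_combination h2 j hj⟩

theorem ExpandsAt.congr_coeff (h : ExpandsAt k J c d n) (hc : ∀ l < n, c l = c' l)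
    (hd : ∀ j < n / (2 * k), d j = d' j) : ExpandsAt k J c' d' n := by
  refine IsLittleO.congr_left h fun t => ?_
  rw [Finset.sum_congr rfl fun l hl => by rw [hc l (Finset.mem_range.1 hl)],
    Finset.sum_congr (s₁ := Finset.range (n / (2 * k))) rfl
      fun j hj => by rw [hd j (Finset.mem_range.1 hj)]]

/-- Finite expansions of different orders agree by uniqueness, so each coefficient can be read off
at the first order where it occurs: `l + 1` for `c`, `2k(j+1)` for `d`. -/
theorem exists_hasLogExpansion (hk : 1 ≤ k) (h : ∀ n, ∃ c d, ∀ m ≤ n, ExpandsAt k J c d m) :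
    ∃ c d, HasLogExpansion k J c d := by
  choose c d h using h
  refine ⟨fun l => c (l + 1) l, fun j => d (2 * k * (j + 1)) j, fun n => ?_⟩
  refine (h n n le_rfl).congr_coeff (fun l hl => ?_) fun j hj => ?_
  · exact (ExpandsAt.coeff_unique hk (fun m hm => h n m (by omega)) (h (l + 1))).1 l
      (Nat.lt_succ_self l)
  · have hle : 2 * k * (j + 1) ≤ n :=
      (Nat.mul_le_mul_left _ hj).trans (Nat.mul_div_le n (2 * k))
    refine (ExpandsAt.coeff_unique hk (fun m hm => h n m (hm.trans hle))
      (h (2 * k * (j + 1)))).2 j ?_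
    rw [Nat.mul_div_cancel_left _ (by omega)]
    exact Nat.lt_succ_self j

/-- Terms beyond order `n` are absorbed into the error. The logarithmic ones have exponent strictly
above `n/(2k)`, which outweighs the logarithm. -/
theorem expandsAt_of_norm_le {Q : ℕ} {N K : ℝ} (hn : (n : ℝ) / (2 * k) < N) (hk : 1 ≤ k)
    (hQ : n ≤ Q)
    (h : ∀ t : ℝ, 1 ≤ t →
      ‖J t - ∑ l ∈ Finset.range Q, c l * ((t ^ (-(((l : ℝ) + 1) / (2 * (k : ℝ)))) : ℝ) : ℂ)
        - ∑ j ∈ Finset.range Q, d j * ((t ^ (-((j : ℝ) + 1)) * Real.log t : ℝ) : ℂ)‖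
      ≤ K * t ^ (-N)) : ExpandsAt k J c d n := by
  have hk0 : (0 : ℝ) < 2 * k := by
    have : (0 : ℝ) < k := by exact_mod_cast hk
    linarith
  have h1 : (fun t : ℝ => J t
      - ∑ l ∈ Finset.range Q, c l * ((t ^ (-(((l : ℝ) + 1) / (2 * (k : ℝ)))) : ℝ) : ℂ)
      - ∑ j ∈ Finset.range Q, d j * ((t ^ (-((j : ℝ) + 1)) * Real.log t : ℝ) : ℂ))
      =o[atTop] fun t : ℝ => t ^ (-((n : ℝ) / (2 * (k : ℝ)))) := by
    refine (IsBigO.of_bound K ?_).trans_isLittleO (isLittleO_rpow_neg hn)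
    filter_upwards [eventually_ge_atTop 1] with t ht
    rw [Real.norm_of_nonneg (Real.rpow_nonneg (by linarith) _)]
    exact h t ht
  have h2 : (fun t : ℝ => ∑ l ∈ Finset.Ico n Q,
      c l * ((t ^ (-(((l : ℝ) + 1) / (2 * (k : ℝ)))) : ℝ) : ℂ))
      =o[atTop] fun t : ℝ => t ^ (-((n : ℝ) / (2 * (k : ℝ)))) := by
    refine IsLittleO.fun_sum fun l hl => ?_
    refine IsLittleO.const_mul_left ?_ _
    rw [Complex.isLittleO_ofReal_left]
    refine isLittleO_rpow_neg ?_
    have : (n : ℝ) ≤ l := by exact_mod_cast (Finset.mem_Ico.1 hl).1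
    gcongr
    linarith
  have h3 : (fun t : ℝ => ∑ j ∈ Finset.Ico (n / (2 * k)) Q,
      d j * ((t ^ (-((j : ℝ) + 1)) * Real.log t : ℝ) : ℂ))
      =o[atTop] fun t : ℝ => t ^ (-((n : ℝ) / (2 * (k : ℝ)))) := by
    refine IsLittleO.fun_sum fun j hj => ?_
    refine IsLittleO.const_mul_left ?_ _
    rw [Complex.isLittleO_ofReal_left]
    refine isLittleO_rpow_neg_mul_log ?_
    have hj' : n < (j + 1) * (2 * k) := by
      rw [← Nat.div_lt_iff_lt_mul (by omega)]
      exact Nat.lt_succ_of_le (Finset.mem_Ico.1 hj).1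
    rw [div_lt_iff₀ hk0]
    exact_mod_cast hj'
  refine ((h1.add h2).add h3).congr_left fun t => ?_
  rw [Finset.sum_Ico_eq_sub _ hQ, Finset.sum_Ico_eq_sub _ ((Nat.div_le_self _ _).trans hQ)]
  ring

theorem UnifExp.expandsAt {ι : Type*} {w : ι → ℝ} {f : ι → ℝ → ℂ} {N : ℝ} {Q : ℕ} (hk : 1 ≤ k)
    (hn : (n : ℝ) / (2 * k) < N) (hQ : n ≤ Q)
    (h : UnifExp w ((Finset.range Q).image (fun l : ℕ => ((l : ℝ) + 1) / (2 * k)))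
      ((Finset.range Q).image (fun j : ℕ => (j : ℝ) + 1)) N f) :
    ∃ C : ℝ, ∀ i, ∃ c d : ℕ → ℂ, (∀ l, ‖c l‖ ≤ C * w i) ∧ (∀ j, ‖d j‖ ≤ C * w i) ∧
      ∀ m ≤ n, ExpandsAt k (f i) c d m := by
  obtain ⟨c, d, C, -, h⟩ := h
  have hk0 : (0 : ℝ) < 2 * k := by
    have : (0 : ℝ) < k := by exact_mod_cast hk
    linarith
  refine ⟨C, fun i => ⟨fun l => c i (((l : ℝ) + 1) / (2 * k)), fun j => d i ((j : ℝ) + 1),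
    fun l => (h i).1 _, fun j => (h i).2.1 _, fun m hm => ?_⟩⟩
  refine expandsAt_of_norm_le (N := N) (K := C * w i) (Q := Q) ?_ hk (hm.trans hQ) fun t ht => ?_
  · refine lt_of_le_of_lt ?_ hn
    gcongr
  · have := (h i).2.2 t ht
    rwa [Finset.sum_image, Finset.sum_image] at this
    · intro x _ y _ hxy
      have : (x : ℝ) = y := by linarith
      exact_mod_cast this
    · intro x _ y _ hxy
      have h1 : (x : ℝ) + 1 = y + 1 := (div_left_inj' hk0.ne').1 hxy
      have : (x : ℝ) = y := by linarith
      exact_mod_cast this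

end Coefficients

/-! ### Test functions as jets, and their expansions -/

section TestFunctions

/-- The coordinate vectors. -/
def coordVec : Fin 3 → ℝ × ℝ × ℝ := ![(1, 0, 0), (0, 1, 0), (0, 0, 1)]

theorem norm_coordVec (i : Fin 3) : ‖coordVec i‖ ≤ 1 := by
  fin_cases i <;> simp [coordVec, Prod.norm_def]

/-- The iterated partial derivative given by a word in the coordinates. -/
noncomputable def wordDeriv (A : ℝ × ℝ × ℝ → ℂ) (w : List (Fin 3)) (z : ℝ × ℝ × ℝ) : ℂ :=
  iteratedFDeriv ℝ w.length A z fun i => coordVec (w.get i)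

theorem norm_wordDeriv_le (A : ℝ × ℝ × ℝ → ℂ) (w : List (Fin 3)) (z : ℝ × ℝ × ℝ) :
    ‖wordDeriv A w z‖ ≤ ‖iteratedFDeriv ℝ w.length A z‖ := by
  refine (ContinuousMultilinearMap.le_opNorm _ _).trans ?_
  refine mul_le_of_le_one_right (norm_nonneg _) ?_
  exact Finset.prod_le_one (fun _ _ => norm_nonneg _) fun _ _ => norm_coordVec _

theorem hasDerivAt_wordDeriv {A : ℝ × ℝ × ℝ → ℂ} {γ : ℝ → ℝ × ℝ × ℝ} {s : ℝ} {i : Fin 3}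
    (w : List (Fin 3)) (hA : ContDiffAt ℝ ∞ A (γ s)) (hγ : HasDerivAt γ (coordVec i) s) :
    HasDerivAt (fun s => wordDeriv A w (γ s)) (wordDeriv A (i :: w) (γ s)) s := by
  have h1 : DifferentiableAt ℝ (iteratedFDeriv ℝ w.length A) (γ s) :=
    hA.differentiableAt_iteratedFDeriv (by exact_mod_cast ENat.natCast_lt_top _)
  have h2 := h1.hasFDerivAt.comp_hasDerivAt s hγ
  exact (ContinuousMultilinearMap.apply ℝ (fun _ : Fin w.length => ℝ × ℝ × ℝ) ℂ
    (fun i => coordVec (w.get i))).hasFDerivAt.comp_hasDerivAt s h2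

theorem openQuadrant_subset_quadrant : openQuadrant ⊆ quadrant :=
  prod_mono_right (prod_mono Ioi_subset_Ici_self Ioi_subset_Ici_self)

theorem openQuadrant_ae_eq_quadrant : openQuadrant =ᵐ[volume] quadrant :=
  Measure.set_prod_ae_eq (ae_eq_refl _) (Measure.set_prod_ae_eq Ioi_ae_eq_Ici Ioi_ae_eq_Ici)

theorem uniqueDiffOn_quadrant : UniqueDiffOn ℝ quadrant :=
  uniqueDiffOn_univ.prod ((uniqueDiffOn_Ici 0).prod (uniqueDiffOn_Ici 0))

theorem isClosed_quadrant : IsClosed quadrant := isClosed_univ.prod (isClosed_Ici.prod isClosed_Ici)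

variable (A : testFunctions)

theorem testFunctions.contDiffAt {z : ℝ × ℝ × ℝ} (hz : z ∈ openQuadrant) :
    ContDiffAt ℝ ∞ (A : ℝ × ℝ × ℝ → ℂ) z :=
  (A.2.1.mono openQuadrant_subset_quadrant).contDiffAt (isOpen_openQuadrant.mem_nhds hz)

/-- Links the ordinary derivatives used in jets to the one-sided ones in the seminorms; on the
interior they coincide. -/
theorem testFunctions.iteratedFDeriv_eq (n : ℕ) {z : ℝ × ℝ × ℝ} (hz : z ∈ openQuadrant) :
    iteratedFDeriv ℝ n (A : ℝ × ℝ × ℝ → ℂ) z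
      = iteratedFDerivWithin ℝ n (A : ℝ × ℝ × ℝ → ℂ) quadrant z :=
  (iteratedFDerivWithin_eq_iteratedFDeriv uniqueDiffOn_quadrant
    ((testFunctions.contDiffAt A hz).of_le (by exact_mod_cast le_top))
    (openQuadrant_subset_quadrant hz)).symm

theorem testFunctions.iteratedFDeriv_eq_zero {R : ℝ}
    (hR : Function.support (A : ℝ × ℝ × ℝ → ℂ) ⊆ Metric.closedBall 0 R) (n : ℕ)
    {z : ℝ × ℝ × ℝ} (hz : R < ‖z‖) : iteratedFDeriv ℝ n (A : ℝ × ℝ × ℝ → ℂ) z = 0 := by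
  by_contra h
  have h1 := closure_minimal hR Metric.isClosed_closedBall (support_iteratedFDeriv_subset n h)
  rw [mem_closedBall_zero_iff] at h1
  linarith

theorem testFunctions.exists_norm_iteratedFDeriv_le {R : ℝ}
    (hR : Function.support (A : ℝ × ℝ × ℝ → ℂ) ⊆ Metric.closedBall 0 R) (n : ℕ) :
    ∃ M, ∀ z ∈ openQuadrant, ‖iteratedFDeriv ℝ n (A : ℝ × ℝ × ℝ → ℂ) z‖ ≤ M := by
  obtain ⟨M, hM⟩ := ((isCompact_closedBall (0 : ℝ × ℝ × ℝ) R).inter_left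
    isClosed_quadrant).exists_bound_of_continuousOn
    ((A.2.1.continuousOn_iteratedFDerivWithin (m := n) (by exact_mod_cast le_top)
      uniqueDiffOn_quadrant).mono inter_subset_left)
  refine ⟨max M 0, fun z hz => ?_⟩
  rcases lt_or_ge R ‖z‖ with h | h
  · rw [testFunctions.iteratedFDeriv_eq_zero A hR n h, norm_zero]
    exact le_max_right _ _
  · rw [testFunctions.iteratedFDeriv_eq A n hz]
    exact (hM z ⟨openQuadrant_subset_quadrant hz, mem_closedBall_zero_iff.2 h⟩).trans
      (le_max_left _ _)

/-- The jet of iterated partial derivatives of a test function. -/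
noncomputable def testFunctions.toJet {R : ℝ} (hR0 : 0 ≤ R)
    (hR : Function.support (A : ℝ × ℝ × ℝ → ℂ) ⊆ Metric.closedBall 0 R) : Jet R where
  nonneg := hR0
  G := wordDeriv A
  continuousOn w := fun z hz => by
    have h1 : DifferentiableAt ℝ (iteratedFDeriv ℝ w.length (A : ℝ × ℝ × ℝ → ℂ)) z :=
      (testFunctions.contDiffAt A hz).differentiableAt_iteratedFDeriv
        (by exact_mod_cast ENat.natCast_lt_top _)
    exact ((ContinuousMultilinearMap.apply ℝ (fun _ : Fin w.length => ℝ × ℝ × ℝ) ℂ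
      (fun i => coordVec (w.get i))).continuous.continuousAt.comp
        h1.continuousAt).continuousWithinAt
  eq_zero w z _ h := by
    rw [wordDeriv, testFunctions.iteratedFDeriv_eq_zero A hR _ h]
    rfl
  bdd w := by
    obtain ⟨M, hM⟩ := testFunctions.exists_norm_iteratedFDeriv_le A hR w.length
    exact ⟨M, fun z hz => (norm_wordDeriv_le A w z).trans (hM z hz)⟩
  deriv₀ w t x y hx hy := hasDerivAt_wordDeriv (γ := fun t => (t, x, y)) w
    (testFunctions.contDiffAt A (mem_openQuadrant.2 ⟨hx, hy⟩))
    ((hasDerivAt_id t).prodMk ((hasDerivAt_const t x).prodMk (hasDerivAt_const t y)))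
  deriv₁ w t x y hx hy := hasDerivAt_wordDeriv (γ := fun x => (t, x, y)) w
    (testFunctions.contDiffAt A (mem_openQuadrant.2 ⟨hx, hy⟩))
    ((hasDerivAt_const x t).prodMk ((hasDerivAt_id x).prodMk (hasDerivAt_const x y)))
  deriv₂ w t x y hx hy := hasDerivAt_wordDeriv (γ := fun y => (t, x, y)) w
    (testFunctions.contDiffAt A (mem_openQuadrant.2 ⟨hx, hy⟩))
    ((hasDerivAt_const y t).prodMk ((hasDerivAt_const y x).prodMk (hasDerivAt_id y)))

variable {A}

theorem testFunctions.integrand_toJet {R : ℝ} (hR0 : 0 ≤ R)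
    (hR : Function.support (A : ℝ × ℝ × ℝ → ℂ) ⊆ Metric.closedBall 0 R) (k : ℕ) (lam : ℝ) :
    (testFunctions.toJet A hR0 hR).integrand k 0 0 0 [] lam = fun z => wave k lam z * A.1 z := by
  ext z
  simp [Jet.integrand, mono, testFunctions.toJet, wordDeriv]

theorem testFunctions.osc_toJet {R : ℝ} (hR0 : 0 ≤ R)
    (hR : Function.support (A : ℝ × ℝ × ℝ → ℂ) ⊆ Metric.closedBall 0 R) (k : ℕ) (lam : ℝ) :
    (testFunctions.toJet A hR0 hR).osc k 0 0 0 [] lam = oscIntegral k A lam := by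
  rw [Jet.osc, testFunctions.integrand_toJet, setIntegral_congr_set openQuadrant_ae_eq_quadrant]
  rfl

variable (A) in
theorem testFunctions.exists_support_subset : ∃ R : ℝ, 0 ≤ R ∧
    Function.support (A : ℝ × ℝ × ℝ → ℂ) ⊆ Metric.closedBall 0 R := by
  obtain ⟨R, hR⟩ := A.2.2.2.isCompact.isBounded.subset_closedBall (0 : ℝ × ℝ × ℝ)
  exact ⟨max R 0, le_max_right _ _, (subset_tsupport _).trans
    (hR.trans (Metric.closedBall_subset_closedBall (le_max_left _ _)))⟩

variable (A) in
theorem testFunctions.integrableOn (k : ℕ) (lam : ℝ) :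
    IntegrableOn (fun z => wave k lam z * A.1 z) quadrant := by
  obtain ⟨R, hR0, hR⟩ := testFunctions.exists_support_subset A
  have h := (testFunctions.toJet A hR0 hR).integrableOn_integrand k 0 0 0 [] lam
  rw [testFunctions.integrand_toJet] at h
  exact h.congr_set_ae openQuadrant_ae_eq_quadrant.symm

theorem oscIntegral_add (k : ℕ) (A B : testFunctions) (lam : ℝ) :
    oscIntegral k (A + B : testFunctions) lam = oscIntegral k A lam + oscIntegral k B lam := by
  refine Eq.trans ?_ (integral_add (testFunctions.integrableOn A k lam)
    (testFunctions.integrableOn B k lam))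
  exact integral_congr_ae (Eventually.of_forall fun z => mul_add _ _ _)

theorem oscIntegral_smul (k : ℕ) (a : ℂ) (A : testFunctions) (lam : ℝ) :
    oscIntegral k (a • A : testFunctions) lam = a * oscIntegral k A lam := by
  refine Eq.trans ?_ (integral_const_mul a _)
  exact integral_congr_ae (Eventually.of_forall fun z => mul_left_comm _ _ _)

/-- Expansion to finite order, with coefficients bounded by the seminorms of the amplitude. -/
theorem exists_expandsAt {k : ℕ} (hk : 1 ≤ k) {R : ℝ} (hR0 : 0 ≤ R) (n : ℕ) :
    ∃ (N : ℕ) (C : ℝ), ∀ A : testFunctions,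
      Function.support (A : ℝ × ℝ × ℝ → ℂ) ⊆ Metric.closedBall 0 R →
      ∀ b : ℝ, (∀ i ≤ N, ∀ z ∈ openQuadrant,
        ‖iteratedFDeriv ℝ i (A : ℝ × ℝ × ℝ → ℂ) z‖ ≤ b) →
      ∃ c d : ℕ → ℂ, (∀ l, ‖c l‖ ≤ C * b) ∧ (∀ j, ‖d j‖ ≤ C * b) ∧
        ∀ m ≤ n, ExpandsAt k (oscIntegral k A) c d m := by
  -- Order `n + 1` puts the error exponent `n + 1 - 1/(4k)` above `n ≥ n/(2k)`.
  obtain ⟨N, Q, h⟩ := BoundedJet.exists_unifExp hk R (n + 1)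
  have hk1 : (1 : ℝ) ≤ k := by exact_mod_cast hk
  have hn : (n : ℝ) / (2 * k) < ((n + 1 : ℕ) : ℝ) - 1 / (4 * k) := by
    have h1 : (n : ℝ) / (2 * k) ≤ n := div_le_self (Nat.cast_nonneg n) (by linarith)
    have h2 : 1 / (4 * (k : ℝ)) ≤ 1 / 4 := by
      gcongr
      linarith
    push_cast
    linarith
  obtain ⟨C, hC⟩ := (h (max Q n) (le_max_left _ _)).expandsAt hk hn (le_max_right _ _)
  refine ⟨N, C, fun A hA b hb => ?_⟩
  obtain ⟨c, d, h1, h2, h3⟩ := hC ⟨(testFunctions.toJet A hR0 hA, b), fun w hw z hz =>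
    (norm_wordDeriv_le A w z).trans (hb _ hw z hz)⟩
  refine ⟨c, d, h1, h2, fun m hm => ?_⟩
  have e := h3 m hm
  have e' : (BoundedJet.wordOsc k [] ⟨(testFunctions.toJet A hR0 hA, b), fun w hw z hz =>
      (norm_wordDeriv_le A w z).trans (hb _ hw z hz)⟩ : ℝ → ℂ) = oscIntegral k A :=
    funext fun t => testFunctions.osc_toJet hR0 hA k t
  rwa [e'] at e

theorem oscIntegral_hasLogExpansion {k : ℕ} (hk : 1 ≤ k) (A : testFunctions) :
    ∃ c d, HasLogExpansion k (oscIntegral k A) c d := by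
  refine exists_hasLogExpansion hk fun n => ?_
  obtain ⟨R, hR0, hR⟩ := testFunctions.exists_support_subset A
  obtain ⟨N, C, h⟩ := exists_expandsAt hk hR0 n
  choose M hM using testFunctions.exists_norm_iteratedFDeriv_le A hR
  -- The sum of the `|M i|` is a single bound for all derivatives up to order `N`.
  obtain ⟨c, d, -, -, h⟩ := h A hR (∑ i ∈ Finset.range (N + 1), |M i|) fun i hi z hz =>
    (hM i z hz).trans ((le_abs_self _).trans (Finset.single_le_sum (f := fun i => |M i|)
      (fun _ _ => abs_nonneg _) (Finset.mem_range.2 (Nat.lt_succ_of_le hi))))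
  exact ⟨c, d, h⟩

theorem HasLogExpansion.coeff_unique {k : ℕ} (hk : 1 ≤ k) {J : ℝ → ℂ} {c d c' d' : ℕ → ℂ}
    (h : HasLogExpansion k J c d) (h' : HasLogExpansion k J c' d') : c = c' ∧ d = d' := by
  refine ⟨funext fun l => ?_, funext fun j => ?_⟩
  · exact (ExpandsAt.coeff_unique hk (n := l + 1) (fun m _ => h m) fun m _ => h' m).1 l
      (Nat.lt_succ_self l)
  · refine (ExpandsAt.coeff_unique hk (n := 2 * k * (j + 1)) (fun m _ => h m)
      fun m _ => h' m).2 j ?_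
    rw [Nat.mul_div_cancel_left _ (by omega)]
    exact Nat.lt_succ_self j

end TestFunctions

end Hyperbolic

/-! ### The coefficients as distributions -/

theorem mainTheorem3 (k : ℕ) (hk : 1 ≤ k) :
    ∃ C D : ℕ → (Hyperbolic.testFunctions →ₗ[ℂ] ℂ),
      (∀ l, Hyperbolic.IsDistribution (C l)) ∧ (∀ j, Hyperbolic.IsDistribution (D j)) ∧
        ∀ A : Hyperbolic.testFunctions,
          Hyperbolic.HasLogExpansion k (Hyperbolic.oscIntegral k A)
            (fun l => C l A) (fun j => D j A) := by
  -- The coefficients are chosen separately for each amplitude; uniqueness makes them linear.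
  choose c d h using Hyperbolic.oscIntegral_hasLogExpansion hk
  have hadd : ∀ A B, c (A + B) = (fun l => c A l + c B l) ∧ d (A + B) = fun j => d A j + d B j := by
    intro A B
    refine Hyperbolic.HasLogExpansion.coeff_unique hk (h (A + B)) ?_
    rw [show Hyperbolic.oscIntegral k (A + B : Hyperbolic.testFunctions) = _ from
      funext (Hyperbolic.oscIntegral_add k A B)]
    exact fun n => Hyperbolic.ExpandsAt.add (h A n) (h B n)
  have hsmul : ∀ (a : ℂ) A, c (a • A) = (fun l => a * c A l) ∧ d (a • A) = fun j => a * d A j := by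
    intro a A
    refine Hyperbolic.HasLogExpansion.coeff_unique hk (h (a • A)) ?_
    rw [show Hyperbolic.oscIntegral k (a • A : Hyperbolic.testFunctions) = _ from
      funext (Hyperbolic.oscIntegral_smul k a A)]
    exact fun n => Hyperbolic.ExpandsAt.const_mul a (h A n)
  have hbound : ∀ (n : ℕ) (K : Set (ℝ × ℝ × ℝ)), IsCompact K → ∃ (N : ℕ) (M : ℝ),
      ∀ A : Hyperbolic.testFunctions, Function.support (A : ℝ × ℝ × ℝ → ℂ) ⊆ K →
        ∀ b : ℝ, (∀ i ≤ N, ∀ x ∈ Hyperbolic.quadrant,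
            ‖iteratedFDerivWithin ℝ i (A : ℝ × ℝ × ℝ → ℂ) Hyperbolic.quadrant x‖ ≤ b) →
          (∀ l < n, ‖c A l‖ ≤ M * b) ∧ ∀ j < n / (2 * k), ‖d A j‖ ≤ M * b := by
    intro n K hK
    obtain ⟨R, hR⟩ := hK.isBounded.subset_closedBall (0 : ℝ × ℝ × ℝ)
    obtain ⟨N, M, hM⟩ := Hyperbolic.exists_expandsAt hk (le_max_right R 0) n
    refine ⟨N, M, fun A hA b hb => ?_⟩
    obtain ⟨c', d', h1, h2, h3⟩ := hM A
      (hA.trans (hR.trans (Metric.closedBall_subset_closedBall (le_max_left _ _)))) b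
      fun i hi z hz => by
        rw [Hyperbolic.testFunctions.iteratedFDeriv_eq A i hz]
        exact hb i hi z (Hyperbolic.openQuadrant_subset_quadrant hz)
    -- By uniqueness the chosen coefficients equal those of the uniform expansion for the ball
    -- containing `K`, and so obey its seminorm bounds.
    obtain ⟨e1, e2⟩ := Hyperbolic.ExpandsAt.coeff_unique hk (fun m _ => h A m) h3
    exact ⟨fun l hl => e1 l hl ▸ h1 l, fun j hj => e2 j hj ▸ h2 j⟩
  refine ⟨fun l => ⟨⟨fun A => c A l, fun A B => congrFun (hadd A B).1 l⟩,
    fun a A => congrFun (hsmul a A).1 l⟩,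
    fun j => ⟨⟨fun A => d A j, fun A B => congrFun (hadd A B).2 j⟩,
    fun a A => congrFun (hsmul a A).2 j⟩, fun l K hK => ?_, fun j K hK => ?_, h⟩
  · obtain ⟨N, M, hM⟩ := hbound (l + 1) K hK
    exact ⟨N, M, fun A hA b hb => (hM A hA b hb).1 l (Nat.lt_succ_self l)⟩
  · obtain ⟨N, M, hM⟩ := hbound (2 * k * (j + 1)) K hK
    refine ⟨N, M, fun A hA b hb => (hM A hA b hb).2 j ?_⟩
    rw [Nat.mul_div_cancel_left _ (by omega)]
    exact Nat.lt_succ_self j
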